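/- Let $X$ be a smooth manifold (finite-dimensional, without boundary), and let $\mathcal U=(U_i)_{i\in I}$ be a good covering of $X$: a finite open covering such that every intersection $U_{i_0\dots i_r}=U_{i_0}\cap\dots\cap U_{i_r}$ is either empty or contractible. Let $(\alpha_i)_{i\in I}$ be a smooth partition of unity with $\operatorname{supp}\alpha_i\subset U_i$. Čech cochains of degree $r$ are families $(c_{i_0\dots i_r})$ of functions on the $U_{i_0\dots i_r}$, which are smooth for the coefficients $S^1$ and locally constant for the coefficients $2i\pi\mathbb Z$ and $i\mathbb R$; the coboundary is $(\partial c)_{i_0\dots i_{r+1}}=\sum_{m}(-1)^m c_{i_0\dots\widehat{i_m}\dots i_{r+1}}$ (written multiplicatively for $S^1$). (a) The connecting homomorphism $$\delta:H^{r}(\mathcal U;S^1)\to H^{r+1}(\mathcal U;2i\pi\mathbb Z)$$ of the exponential sequence $0\to 2i\pi\mathbb Z\to i\mathbb R\to S^1\to 0$ is well defined: every $S^1$-valued $r$-cocycle $\lambda$ has a lift $u=(u_{i_0\dots i_r})$, with $u_{i_0\dots i_r}$ a smooth $i\mathbb R$-valued function and $e^{u}=\lambda$; for every such lift, $\partial u$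 is a $2i\pi\mathbb Z$-valued cocycle, and its class $\delta[\lambda]=[\partial u]$ depends only on $[\lambda]$. (b) The assignment $$c\longmapsto f(c)=\sum_{(i_0,\dots,i_{r+1})}\alpha_{i_0}\,d\alpha_{i_1}\wedge\dots\wedge d\alpha_{i_{r+1}}\cdot c_{i_0\dots i_{r+1}}$$ sends $i\mathbb R$-valued Čech cocycles to smooth closed forms on $X$ and induces a homomorphism $\Phi:H^{r+1}(\mathcal U;i\mathbb R)\to H^{r+1}_{dR}(X;i\mathbb R)$. (c) Let $\lambda=(\lambda_{i_0\dots i_r})$, $r\ge 0$, be an $r$-cocycle on $\mathcal U$ with values in $S^1$. There is a smooth closed $i\mathbb R$-valued differential form $\omega$ of degree $r+1$ on $X$ which is given on each open set $U_{i_0}$ by $$\omega=(-1)^{r+1}\sum_{(i_1,\dots,i_r)}d\alpha_{i_1}\wedge\dots\wedge d\alpha_{i_r}\wedge(\lambda_{i_0i_1\dots i_r})^{-1}\,d\lambda_{i_0i_1\dots i_r},$$ and its de Rham class is the image of $[\lambda]$ under the composite $$H^{r}(\mathcal U;S^1)\xrightarrow{\ \delta\ }H^{r+1}(\mathcal U;2i\pi\mathbb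 Z)\to H^{r+1}(\mathcal U;i\mathbb R)\xrightarrow{\ \Phi\ }H^{r+1}_{dR}(X;i\mathbb R).$$ -/

import Mathlib

open scoped Manifold ContDiff
open TopologicalSpace

noncomputable section

namespace CechDeRham

/-! ### The coefficient groups `iℝ`, `2πiℤ` and the exponential `iℝ → S¹` -/

/-- The real line `iℝ` of purely imaginary complex numbers. -/
abbrev ImLine : Submodule ℝ ℂ := LinearMap.ker Complex.reLm

theorem ImLine.eq_im_mul_I (z : ImLine) : (z : ℂ) = (z : ℂ).im * Complex.I := by
  have h : (z : ℂ).re = 0 := z.2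
  apply Complex.ext <;> simp [h]

/-- The element `2πi` of `iℝ`. -/
def twoPiI : ImLine := ⟨2 * Real.pi * Complex.I, by simp⟩

/-- The subgroup `2πiℤ` of `iℝ`. -/
abbrev TwoPiIZ : AddSubgroup ImLine := AddSubgroup.zmultiples twoPiI

/-- The exponential `iℝ → S¹`, as a homomorphism from `iℝ` to the group `S¹` written additively. -/
def expIm : ImLine →+ Additive Circle where
  toFun z := Additive.ofMul (Circle.exp (z : ℂ).im)
  map_zero' := by simp
  map_add' z w := by simp [Circle.exp_add]

theorem coe_expIm (z : ImLine) : (((expIm z).toMul : Circle) : ℂ) = Complex.exp z := by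
  rw [ImLine.eq_im_mul_I z]
  simp [expIm]

/-! ### Čech cohomology of a cover with values in a sheaf of functions -/

section Cech

variable {X : Type*} [TopologicalSpace X] {G G' : Type*} [AddCommGroup G] [AddCommGroup G']
  {ι : Type*}

/-- A presheaf of abelian groups consisting of functions with values in a fixed abelian group `G`:
a subgroup of the group of all functions `U → G` for each open set `U`, stable under restriction. -/
structure FunPresheaf (X : Type*) [TopologicalSpace X] (G : Type*) [AddCommGroup G] where
  /-- The sections over an open set. -/
  sec : ∀ U : Opens X, AddSubgroup (U → G)
  /-- Restrictions of sections are sections. -/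
  res_mem : ∀ {U V : Opens X} (h : V ≤ U) {f : U → G}, f ∈ sec U →
    (fun x : V => f ⟨x, h x.2⟩) ∈ sec V

/-- Restriction of sections to a smaller open set. -/
def FunPresheaf.res (F : FunPresheaf X G) {U V : Opens X} (h : V ≤ U) : F.sec U →+ F.sec V where
  toFun f := ⟨fun x => f.1 ⟨x, h x.2⟩, F.res_mem h f.2⟩
  map_zero' := rfl
  map_add' _ _ := rfl

/-- The sheaf of locally constant functions with values in `A`, that is, of continuous functions to
`A` with the discrete topology. -/
def locConst (X : Type*) [TopologicalSpace X] (A : Type*) [AddCommGroup A] : FunPresheaf X A where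
  sec _ :=
    { carrier := {f | IsLocallyConstant f}
      zero_mem' := IsLocallyConstant.const 0
      add_mem' := fun hf hg => hf.add hg
      neg_mem' := fun hf => hf.neg }
  res_mem h _ hf := hf.comp_continuous (by fun_prop)

/-- The intersection `U_{J 0} ∩ … ∩ U_{J (k - 1)}`. -/
def inter (U : ι → Opens X) {k : ℕ} (J : Fin k → ι) : Opens X :=
  ⟨⋂ m, (U (J m) : Set X), isOpen_iInter_of_finite fun m => (U (J m)).2⟩

theorem inter_le_face (U : ι → Opens X) {k : ℕ} (J : Fin (k + 1) → ι) (m : Fin (k + 1)) :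
    inter U J ≤ inter U (J ∘ m.succAbove) := fun _ hx =>
  Set.mem_iInter.2 fun l => Set.mem_iInter.1 hx (m.succAbove l)

/-- A good cover: open sets covering the space all of whose finite intersections are empty or
contractible (the index set is assumed finite where this is used). -/
structure IsGoodCover (U : ι → Opens X) : Prop where
  covers : ∀ x, ∃ i, x ∈ U i
  contractible : ∀ (r : ℕ) (J : Fin (r + 1) → ι),
    (inter U J : Set X).Nonempty → ContractibleSpace (inter U J)

/-- Čech cochains of degree `r`: families `c_{i₀…i_r}` of sections over
`U_{i₀} ∩ … ∩ U_{i_r}`. -/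
abbrev Cochain (F : FunPresheaf X G) (U : ι → Opens X) (r : ℕ) : Type _ :=
  ∀ J : Fin (r + 1) → ι, F.sec (inter U J)

/-- The Čech coboundary `(∂c)_{i₀…i_{r+1}} = ∑ₘ (-1)ᵐ c_{i₀…îₘ…i_{r+1}}`. -/
def cobd (F : FunPresheaf X G) (U : ι → Opens X) (r : ℕ) :
    Cochain F U r →+ Cochain F U (r + 1) where
  toFun c J := ∑ m : Fin (r + 2),
    (-1 : ℤ) ^ (m : ℕ) • F.res (inter_le_face U J m) (c (J ∘ m.succAbove))
  map_zero' := by funext J; simp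
  map_add' c c' := by funext J; simp [Finset.sum_add_distrib]

/-- Čech cocycles. -/
def cocycles (F : FunPresheaf X G) (U : ι → Opens X) (r : ℕ) : AddSubgroup (Cochain F U r) :=
  (cobd F U r).ker

/-- Čech coboundaries. -/
def coboundaries (F : FunPresheaf X G) (U : ι → Opens X) : ∀ r, AddSubgroup (Cochain F U r)
  | 0 => ⊥
  | r + 1 => (cobd F U r).range

/-- The Čech cohomology group `Hʳ(U; F)`. -/
abbrev CechH (F : FunPresheaf X G) (U : ι → Opens X) (r : ℕ) : Type _ :=
  cocycles F U r ⧸ (coboundaries F U r).addSubgroupOf (cocycles F U r)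

/-- The Čech cohomology class of a cocycle. -/
def CechH.mk {F : FunPresheaf X G} {U : ι → Opens X} {r : ℕ} (c : cocycles F U r) : CechH F U r :=
  QuotientAddGroup.mk c

/-- The map on cochains with locally constant coefficients induced by a homomorphism. -/
def mapCochain (φ : G →+ G') (U : ι → Opens X) (r : ℕ) :
    Cochain (locConst X G) U r →+ Cochain (locConst X G') U r where
  toFun c J := ⟨fun x => φ ((c J).1 x), (c J).2.comp φ⟩
  map_zero' := by funext J; ext x; simp
  map_add' c c' := by funext J; ext x; simp

theorem mapCochain_cobd (φ : G →+ G') (U : ι → Opens X) (r : ℕ)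
    (c : Cochain (locConst X G) U r) :
    mapCochain φ U (r + 1) (cobd _ U r c) = cobd _ U r (mapCochain φ U r c) := by
  funext J
  ext x
  simp [mapCochain, cobd, FunPresheaf.res]

theorem mapCochain_mem_cocycles (φ : G →+ G') (U : ι → Opens X) (r : ℕ)
    {c : Cochain (locConst X G) U r} (hc : c ∈ cocycles (locConst X G) U r) :
    mapCochain φ U r c ∈ cocycles (locConst X G') U r := by
  have h : cobd (locConst X G) U r c = 0 := hc
  change cobd _ U r (mapCochain φ U r c) = 0
  rw [← mapCochain_cobd, h, map_zero]

theorem mapCochain_mem_coboundaries (φ : G →+ G') (U : ι → Opens X) (r : ℕ)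
    {c : Cochain (locConst X G) U r} (hc : c ∈ coboundaries (locConst X G) U r) :
    mapCochain φ U r c ∈ coboundaries (locConst X G') U r := by
  cases r with
  | zero =>
    have h : c = 0 := hc
    rw [h, map_zero]
    exact zero_mem _
  | succ r =>
    obtain ⟨b, rfl⟩ := hc
    exact ⟨mapCochain φ U r b, (mapCochain_cobd φ U r b).symm⟩

/-- The map `Hʳ(U; G) → Hʳ(U; G')` induced by a homomorphism of discrete coefficient groups. -/
def mapCechH (φ : G →+ G') (U : ι → Opens X) (r : ℕ) :
    CechH (locConst X G) U r →+ CechH (locConst X G') U r :=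
  QuotientAddGroup.map _ _
    (((mapCochain φ U r).comp (cocycles (locConst X G) U r).subtype).codRestrict
      (cocycles (locConst X G') U r) fun c => mapCochain_mem_cocycles φ U r c.2)
    (fun _ hc => mapCochain_mem_coboundaries φ U r hc)

/-- Extension of a function on an open set by zero. -/
def extZero {U : Opens X} {A : Type*} [Zero A] (f : U → A) (x : X) : A :=
  open Classical in if h : x ∈ U then f ⟨x, h⟩ else 0

end Cech

/-! ### Differential forms and de Rham cohomology -/

section Forms

variable {E : Type*} [NormedAddCommGroup E] [NormedSpace ℝ E]
  {M : Type*} [TopologicalSpace M] [ChartedSpace E M]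
  {V : Type*} [NormedAddCommGroup V] [NormedSpace ℝ V]

/-- Not necessarily smooth differential forms of degree `k` on `M` with values in `V`: families of
alternating `k`-linear maps on the tangent spaces `T_x M = TangentSpace 𝓘(ℝ, E) x`. By definition,
`TangentSpace 𝓘(ℝ, E) x` is the model space `E` (tangent vectors at `x` are written in the preferred
chart at `x`, and `mfderiv` accounts for changes of charts). -/
abbrev Form (E M V : Type*) [NormedAddCommGroup E] [NormedSpace ℝ E]
    [NormedAddCommGroup V] [NormedSpace ℝ V] (k : ℕ) : Type _ := M → E [⋀^Fin k]→L[ℝ] V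

/-- The derivative at `y` of the inverse `φ⁻¹` of the preferred chart `φ` at `x₀`, as a map
`E = T_y E → T_{φ⁻¹(y)} M`. -/
def chartSymmDeriv (x₀ : M) (y : E) : E →L[ℝ] E :=
  mfderiv 𝓘(ℝ, E) 𝓘(ℝ, E) (extChartAt 𝓘(ℝ, E) x₀).symm y

variable (E) in
/-- The derivative at `x` of the preferred chart at `x`, as a map `T_x M → E`. -/
def chartDeriv (x : M) : E →L[ℝ] E :=
  mfderiv 𝓘(ℝ, E) 𝓘(ℝ, E) (extChartAt 𝓘(ℝ, E) x) x

/-- The expression of a form in the preferred chart `φ` at `x₀`, i.e. its pullback under `φ⁻¹`. -/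
def inChart {k : ℕ} (x₀ : M) (θ : Form E M V k) (y : E) : E [⋀^Fin k]→L[ℝ] V :=
  (θ ((extChartAt 𝓘(ℝ, E) x₀).symm y)).compContinuousLinearMap (chartSymmDeriv x₀ y)

/-- Smoothness of a form: its expressions in charts are smooth. -/
def IsSmoothForm {k : ℕ} (θ : Form E M V k) : Prop :=
  ∀ x₀ : M, ContDiffOn ℝ ∞ (inChart x₀ θ) (extChartAt 𝓘(ℝ, E) x₀).target

/-- The exterior derivative; its value at `x` is computed in the preferred chart at `x`. -/
def extD {k : ℕ} (θ : Form E M V k) : Form E M V (k + 1) := fun x =>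
  (extDeriv (inChart x θ) (extChartAt 𝓘(ℝ, E) x x)).compContinuousLinearMap
    (chartDeriv E x)

theorem inChart_zero {k : ℕ} (x₀ : M) : inChart x₀ (0 : Form E M V k) = 0 := by
  funext y; ext v; simp [inChart]

theorem inChart_add {k : ℕ} (x₀ : M) (θ η : Form E M V k) :
    inChart x₀ (θ + η) = inChart x₀ θ + inChart x₀ η := by
  funext y; ext v; simp [inChart]

theorem inChart_smul {k : ℕ} (x₀ : M) (a : ℝ) (θ : Form E M V k) :
    inChart x₀ (a • θ) = a • inChart x₀ θ := by
  funext y; ext v; simp [inChart]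

theorem IsSmoothForm.zero {k : ℕ} : IsSmoothForm (0 : Form E M V k) := fun x₀ => by
  rw [inChart_zero]; exact contDiffOn_const

theorem IsSmoothForm.add {k : ℕ} {θ η : Form E M V k} (hw : IsSmoothForm θ)
    (hη : IsSmoothForm η) : IsSmoothForm (θ + η) := fun x₀ => by
  rw [inChart_add]; exact (hw x₀).add (hη x₀)

theorem IsSmoothForm.smul {k : ℕ} (a : ℝ) {θ : Form E M V k} (hw : IsSmoothForm θ) :
    IsSmoothForm (a • θ) := fun x₀ => by
  rw [inChart_smul]; exact (hw x₀).const_smul a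

theorem IsSmoothForm.differentiableAt {k : ℕ} {θ : Form E M V k} (hw : IsSmoothForm θ) (x : M) :
    DifferentiableAt ℝ (inChart x θ) (extChartAt 𝓘(ℝ, E) x x) :=
  ((hw x).contDiffAt (extChartAt_target_mem_nhds x)).differentiableAt (by simp)

theorem extD_zero {k : ℕ} : extD (0 : Form E M V k) = 0 := by
  funext x; ext v
  have h : extDeriv (0 : E → E [⋀^Fin k]→L[ℝ] V) (extChartAt 𝓘(ℝ, E) x x) = 0 := by
    simpa using extDeriv_smul (0 : ℝ) (0 : E → E [⋀^Fin k]→L[ℝ] V) (x := extChartAt 𝓘(ℝ, E) x x)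
  rw [extD, inChart_zero, h]; simp

theorem extD_add {k : ℕ} {θ η : Form E M V k} (hw : IsSmoothForm θ) (hη : IsSmoothForm η) :
    extD (θ + η) = extD θ + extD η := by
  funext x; ext v
  simp only [extD, inChart_add, Pi.add_apply]
  rw [extDeriv_add (hw.differentiableAt x) (hη.differentiableAt x)]
  simp

theorem extD_smul {k : ℕ} (a : ℝ) (θ : Form E M V k) : extD (a • θ) = a • extD θ := by
  funext x; ext v; simp [extD, inChart_smul, extDeriv_smul]

variable (E M V) in
/-- The space of smooth closed forms. -/
def closedForms (k : ℕ) : Submodule ℝ (Form E M V k) where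
  carrier := {θ | IsSmoothForm θ ∧ extD θ = 0}
  zero_mem' := ⟨.zero, extD_zero⟩
  add_mem' hw hη := ⟨hw.1.add hη.1, by rw [extD_add hw.1 hη.1, hw.2, hη.2, add_zero]⟩
  smul_mem' a _ hw := ⟨hw.1.smul a, by rw [extD_smul, hw.2, smul_zero]⟩

variable (E M V) in
/-- The space of exact forms, i.e. exterior derivatives of smooth forms. -/
def exactForms : ∀ k : ℕ, Submodule ℝ (Form E M V k)
  | 0 => ⊥
  | _ + 1 =>
    { carrier := {θ | ∃ η, IsSmoothForm η ∧ extD η = θ}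
      zero_mem' := ⟨0, .zero, extD_zero⟩
      add_mem' := by
        rintro _ _ ⟨η, hη, rfl⟩ ⟨η', hη', rfl⟩
        exact ⟨η + η', hη.add hη', extD_add hη hη'⟩
      smul_mem' := by
        rintro a _ ⟨η, hη, rfl⟩
        exact ⟨a • η, hη.smul a, extD_smul a η⟩ }

variable (E M V) in
/-- The de Rham cohomology group `Hᵏ_dR(M; V)`. -/
abbrev DeRhamH (k : ℕ) : Type _ :=
  closedForms E M V k ⧸ (exactForms E M V k).comap (closedForms E M V k).subtype

/-- The de Rham class of a closed form. -/
def DeRhamH.mk {k : ℕ} (θ : closedForms E M V k) : DeRhamH E M V k := Submodule.Quotient.mk θ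

/-- The exterior product `η ∧ θ` of a linear form and a `V`-valued alternating form:
`(η ∧ θ)(v₀, …, v_k) = ∑ᵢ (-1)ⁱ η(vᵢ) θ(v₀, …, v̂ᵢ, …, v_k)`. -/
def wedge {k : ℕ} (η : E →L[ℝ] ℝ) (θ : E [⋀^Fin k]→L[ℝ] V) : E [⋀^Fin (k + 1)]→L[ℝ] V :=
  .alternatizeUncurryFin (η.smulRight θ)

/-- `η₁ ∧ … ∧ η_r · c` for linear forms `η₁, …, η_r` and a vector `c`. -/
def wedgeConst : ∀ r : ℕ, (Fin r → E →L[ℝ] ℝ) → V → E [⋀^Fin r]→L[ℝ] V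
  | 0, _, c => .constOfIsEmpty ℝ E (Fin 0) c
  | r + 1, η, c => wedge (η 0) (wedgeConst r (fun j => η j.succ) c)

/-- `η₁ ∧ … ∧ η_r ∧ β` for linear forms `η₁, …, η_r` and a `V`-valued linear form `β`. -/
def wedgeOne : ∀ r : ℕ, (Fin r → E →L[ℝ] ℝ) → (E →L[ℝ] V) → E [⋀^Fin (r + 1)]→L[ℝ] V
  | 0, _, β => .ofSubsingleton ℝ E V (0 : Fin 1) β
  | r + 1, η, β => wedge (η 0) (wedgeOne r (fun j => η j.succ) β)

end Forms

/-! ### Čech cochains and forms on a manifold -/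

section Manifold

variable (E : Type*) [NormedAddCommGroup E] [NormedSpace ℝ E]
  (M : Type*) [TopologicalSpace M] [ChartedSpace E M]

/-- The sheaf of smooth functions with values in `iℝ`. -/
def smoothIm : FunPresheaf M ImLine where
  sec _ :=
    { carrier := {f | ContMDiff 𝓘(ℝ, E) 𝓘(ℝ, ImLine) ∞ f}
      zero_mem' := contMDiff_const
      add_mem' := fun hf hg => hf.add hg
      neg_mem' := fun hf => hf.neg }
  res_mem h _ hf := hf.comp (contMDiff_inclusion h)

/-- The sheaf of smooth functions with values in `S¹`, written additively. -/
def smoothCircle : FunPresheaf M (Additive Circle) where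
  sec _ :=
    { carrier := {f | ContMDiff 𝓘(ℝ, E) (𝓡 1) ∞ fun x => (f x).toMul}
      zero_mem' := contMDiff_const
      add_mem' := fun hf hg => ContMDiff.mul hf hg
      neg_mem' := fun hf => ContMDiff.inv hf }
  res_mem {U V} h f hf := by
    have hf' : ContMDiff 𝓘(ℝ, E) (𝓡 1) ∞ fun x : U => (f x).toMul := hf
    exact hf'.comp (contMDiff_inclusion h)

variable {E M} {ι : Type*}

/-- The smooth `iℝ`-valued cochain `u` is a logarithm of the `S¹`-valued cochain `l`: `e^u = l`. -/
def IsLogarithm (U : ι → Opens M) {r : ℕ} (u : Cochain (smoothIm E M) U r)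
    (l : Cochain (smoothCircle E M) U r) : Prop :=
  ∀ J x, expIm ((u J).1 x) = (l J).1 x

/-- `δ` is the connecting homomorphism `Hʳ(U; S¹) → Hʳ⁺¹(U; 2πiℤ)` of the exact sequence
`0 → 2πiℤ → iℝ → S¹ → 0`: every cocycle `l` has a logarithm and, for every logarithm `u` of `l`, the
coboundary `∂u` is a `2πiℤ`-valued cocycle `c` and `δ [l] = [c]`. -/
def IsConnectingHom (U : ι → Opens M) {r : ℕ}
    (δ : CechH (smoothCircle E M) U r →+ CechH (locConst M TwoPiIZ) U (r + 1)) : Prop :=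
  ∀ l : cocycles (smoothCircle E M) U r,
    (∃ u : Cochain (smoothIm E M) U r, IsLogarithm U u l.1) ∧
    ∀ u : Cochain (smoothIm E M) U r, IsLogarithm U u l.1 →
      ∃ c : cocycles (locConst M TwoPiIZ) U (r + 1),
        (∀ J x, (((c.1 J).1 x : TwoPiIZ) : ImLine) = (cobd (smoothIm E M) U r u J).1 x) ∧
        δ (CechH.mk l) = CechH.mk c

/-- The differential of a real-valued function at `x`, as a linear form on `T_x M`. -/
def diff (f : M → ℝ) (x : M) : E →L[ℝ] ℝ := mvfderiv 𝓘(ℝ, E) f x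

/-- The form `f_r(c) = ∑ α_{i₀} dα_{i₁} ∧ … ∧ dα_{i_r} · c_{i₀…i_r}` associated to a Čech cochain
with values in the discrete group `V`. -/
def cechForm {V : Type*} [NormedAddCommGroup V] [NormedSpace ℝ V] [Fintype ι] (U : ι → Opens M)
    (α : SmoothPartitionOfUnity ι 𝓘(ℝ, E) M) {r : ℕ} (c : Cochain (locConst M V) U r) :
    Form E M V r := fun x =>
  ∑ J : Fin (r + 1) → ι,
    α (J 0) x • wedgeConst (E := E) r (fun j => diff (E := E) (α (J j.succ)) x) (extZero (c J).1 x)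

/-- `Φ` is the map `Hʳ(U; V) → Hʳ_dR(M; V)` induced by `c ↦ f_r(c)`. -/
def IsCechDeRhamMap {V : Type*} [NormedAddCommGroup V] [NormedSpace ℝ V] [Fintype ι]
    (U : ι → Opens M) (α : SmoothPartitionOfUnity ι 𝓘(ℝ, E) M) {r : ℕ}
    (Φ : CechH (locConst M V) U r →+ DeRhamH E M V r) : Prop :=
  ∀ c : cocycles (locConst M V) U r, ∃ h : cechForm U α c.1 ∈ closedForms E M V r,
    Φ (CechH.mk c) = DeRhamH.mk ⟨cechForm U α c.1, h⟩

/-- For a function `l : W → S¹ ⊆ ℂ` on an open set, its differential `dl` at a point of `W`, as a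
complex-valued linear form on the tangent space. -/
def diffCircle {W : Opens M} (l : W → Additive Circle) (x : M) :
    E →L[ℝ] ℂ :=
  mvfderiv 𝓘(ℝ, E) (extZero fun y => (((l y).toMul : Circle) : ℂ)) x

theorem inv_mul_diffCircle_mem {W : Opens M} (l : W → Additive Circle) (x : W)
    (v : E) :
    ((((l x).toMul : Circle) : ℂ)⁻¹ • diffCircle (E := E) l x) v ∈ ImLine := by
  set F : M → ℂ := extZero fun y => (((l y).toMul : Circle) : ℂ) with hF
  have hFx : ∀ y : W, F y = (((l y).toMul : Circle) : ℂ) := fun y => by simp [hF, extZero]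
  by_cases hd : MDifferentiableAt 𝓘(ℝ, E) 𝓘(ℝ, ℂ) F x
  · have h1 := hd.hasMFDerivAt
    have h2 : HasFDerivAt (fun z : ℂ => ‖z‖ ^ 2) (2 • innerSL ℝ (F x)) (F x) :=
      (hasStrictFDerivAt_norm_sq (F x)).hasFDerivAt
    have h3 := h2.hasMFDerivAt.comp (x : M) h1
    have h4 : (fun z : ℂ => ‖z‖ ^ 2) ∘ F =ᶠ[nhds (x : M)] fun _ => (1 : ℝ) := by
      filter_upwards [W.2.mem_nhds x.2] with y hy
      have := Circle.norm_coe (l ⟨y, hy⟩).toMul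
      simp [hFx ⟨y, hy⟩, this]
    have h5 := (hasMFDerivAt_const (I := 𝓘(ℝ, E)) (I' := 𝓘(ℝ, ℝ)) (1 : ℝ) (x : M)).congr_of_eventuallyEq h4
    have h6 := congrArg (fun T => T v) (hasMFDerivAt_unique h3 h5)
    have h7 : (2 : ℝ) * inner ℝ (F x) (diffCircle (E := E) l x v) = 0 := by
      have h8 : (2 • innerSL ℝ (F x)) (diffCircle (E := E) l x v) = 0 := h6
      simp only [smul_apply, nsmul_eq_mul, innerSL_apply_apply, Nat.cast_ofNat] at h8
      exact h8
    have h8 : inner ℝ (F x) (diffCircle (E := E) l x v) = 0 := by linarith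
    rw [Complex.inner, hFx x] at h8
    rw [LinearMap.mem_ker, ← Circle.coe_inv, Circle.coe_inv_eq_conj]
    simp only [smul_apply, smul_eq_mul, Complex.reLm_coe]
    rw [mul_comm]
    exact h8
  · have h0 : diffCircle (E := E) l x = 0 := by
      rw [diffCircle, mvfderiv, ← hF, mfderiv_zero_of_not_mdifferentiableAt hd]
      rfl
    simp [h0]

/-- The logarithmic differential `l⁻¹ dl` of a function `l : W → S¹` on an open set, as an
`iℝ`-valued linear form on the tangent space at `x ∈ W`; zero for `x ∉ W`. -/
def logDiff {W : Opens M} (l : W → Additive Circle) (x : M) :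
    E →L[ℝ] ImLine :=
  open Classical in
  if h : x ∈ W then
    ((((l ⟨x, h⟩).toMul : Circle) : ℂ)⁻¹ • diffCircle (E := E) l x).codRestrict ImLine
      (inv_mul_diffCircle_mem l ⟨x, h⟩)
  else 0

end Manifold

end CechDeRham

end

/-!
Write `f(c) = ∑ α_{i₀} dα_{i₁} ∧ … ∧ dα_{i_r} · c_{i₀…i_r}` for the form of a Čech cochain `c` with
values in any sheaf of smooth vector-valued functions (`cochainForm`). Everything about `f` follows
from one formula (`extD_cochainForm`),
`d f(c) = f(∂c) + (-1)ʳ ∑ α_{i₀} dα_{i₁} ∧ … ∧ dα_{i_r} ∧ dc_{i₀…i_r}`.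
It is the Leibniz rule together with `f(∂c) = ∑ dα_{i₀} ∧ … ∧ dα_{i_r} · c_{i₀…i_r}`
(`cochainForm_cobd`), where the faces of `∂c` that keep `i₀` cancel because `∑ dα_i = 0`, and the
remaining one gives the right-hand side because `∑ α_i = 1` (`sum_weighted_coboundary`).

For locally constant `c` the formula reads `d f(c) = f(∂c)`: cocycles give closed forms and
coboundaries give exact ones, so `f` induces the map `Φ` (`exists_isCechDeRhamMap`).

A circle-valued cochain has a smooth logarithm, because the members of a good cover and their
intersections are simply connected and `ℝ → S¹` is a covering (`exists_smooth_log`). The usual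
diagram chase then yields the connecting homomorphism `δ` (`exists_isConnectingHom`).

If `u` is a logarithm of the circle-valued cocycle `l`, then `δ [l]` is represented by `∂u`, and its
image in de Rham cohomology by `f(∂u)`, hence also by
`f(∂u) - d f(u) = (-1)ʳ⁺¹ ∑ α_{i₀} dα_{i₁} ∧ … ∧ dα_{i_r} ∧ du_{i₀…i_r}`. Since `∂u` is locally
constant, `du` is a Čech cocycle, and `du = l⁻¹ dl`; the same cancellation replaces the average over
`i₀` by its value at any `i₀` with `x ∈ U_{i₀}` (`cochainOneForm_eq_of_cocycle`,
`cochainForm_cobd_sub_extD`).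

The exterior derivative `extD` is computed at each point in the preferred chart there. All forms
that occur are locally sums of `da₁ ∧ … ∧ da_r · b` or `da₁ ∧ … ∧ da_r ∧ db` with functions `a_j`
and `b` smooth near the point, and differentials of functions are compatible with charts. Hence the formulas
`d(da₁ ∧ … ∧ da_r · b) = (-1)ʳ da₁ ∧ … ∧ da_r ∧ db` and `d(da₁ ∧ … ∧ da_r ∧ db) = 0` on the model
space suffice, and the independence of `extD` of the chart is never needed.
-/

noncomputable section

namespace CechDeRham

/-! ### Exterior products with linear forms -/

section WedgeAlgebra

variable {E : Type*} [NormedAddCommGroup E] [NormedSpace ℝ E]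
  {V : Type*} [NormedAddCommGroup V] [NormedSpace ℝ V]

variable (E V) in
/-- The exterior product `wedge` as a continuous bilinear map. -/
def wedgeL (k : ℕ) :
    (E →L[ℝ] ℝ) →L[ℝ] (E [⋀^Fin k]→L[ℝ] V) →L[ℝ] E [⋀^Fin (k + 1)]→L[ℝ] V :=
  (ContinuousLinearMap.compL ℝ _ _ _ (ContinuousAlternatingMap.alternatizeUncurryFinCLM ℝ E V)) ∘L
    ContinuousLinearMap.smulRightL ℝ E (E [⋀^Fin k]→L[ℝ] V)

theorem wedgeL_apply {k : ℕ} (η : E →L[ℝ] ℝ) (θ : E [⋀^Fin k]→L[ℝ] V) :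
    wedgeL E V k η θ = wedge η θ := rfl

theorem wedge_comp {F : Type*} [NormedAddCommGroup F] [NormedSpace ℝ F] {k : ℕ} (η : E →L[ℝ] ℝ)
    (θ : E [⋀^Fin k]→L[ℝ] V) (A : F →L[ℝ] E) :
    (wedge η θ).compContinuousLinearMap A = wedge (η ∘L A) (θ.compContinuousLinearMap A) := by
  ext v
  simp only [wedge, ContinuousAlternatingMap.compContinuousLinearMap_apply,
    ContinuousAlternatingMap.alternatizeUncurryFin_apply]
  refine Finset.sum_congr rfl fun i _ => ?_
  rfl

theorem wedge_wedge_comm {k : ℕ} (η ζ : E →L[ℝ] ℝ) (θ : E [⋀^Fin k]→L[ℝ] V) :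
    wedge η (wedge ζ θ) = -wedge ζ (wedge η θ) := by
  -- the symmetrization of `η ⊗ ζ ⊗ θ` in the first two arguments has zero double alternation
  have h :=
    ContinuousAlternatingMap.alternatizeUncurryFin_alternatizeUncurryFinCLM_comp_of_symmetric
    (f := η.smulRight (ζ.smulRight θ) + ζ.smulRight (η.smulRight θ)) (fun x y => by
      simp [smul_smul, add_comm, mul_comm])
  have h' : (ContinuousAlternatingMap.alternatizeUncurryFinCLM ℝ E V).comp
      (η.smulRight (ζ.smulRight θ) + ζ.smulRight (η.smulRight θ)) =
      η.smulRight (wedge ζ θ) + ζ.smulRight (wedge η θ) := by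
    ext1 x
    simp [wedge]
  rw [h', ContinuousAlternatingMap.alternatizeUncurryFin_add] at h
  exact eq_neg_of_add_eq_zero_left h

theorem wedgeConst_comp {F : Type*} [NormedAddCommGroup F] [NormedSpace ℝ F] (A : F →L[ℝ] E)
    (c : V) : ∀ (r : ℕ) (η : Fin r → E →L[ℝ] ℝ),
    (wedgeConst r η c).compContinuousLinearMap A = wedgeConst r (fun j => η j ∘L A) c
  | 0, _ => rfl
  | r + 1, η => by
    rw [wedgeConst, wedge_comp, wedgeConst_comp A c r]; rfl

theorem wedgeOne_comp {F : Type*} [NormedAddCommGroup F] [NormedSpace ℝ F] (A : F →L[ℝ] E)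
    (β : E →L[ℝ] V) : ∀ (r : ℕ) (η : Fin r → E →L[ℝ] ℝ),
    (wedgeOne r η β).compContinuousLinearMap A = wedgeOne r (fun j => η j ∘L A) (β ∘L A)
  | 0, _ => rfl
  | r + 1, η => by
    rw [wedgeOne, wedge_comp, wedgeOne_comp A β r]; rfl

/-- `wedgeConst` as a linear map in its last argument. -/
def wedgeConstL : ∀ r : ℕ, (Fin r → E →L[ℝ] ℝ) → V →L[ℝ] E [⋀^Fin r]→L[ℝ] V
  | 0, _ => (ContinuousAlternatingMap.constOfIsEmptyLIE ℝ E V (Fin 0)).toContinuousLinearEquiv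
  | r + 1, η => wedgeL E V r (η 0) ∘L wedgeConstL r fun j => η j.succ

theorem wedgeConstL_apply (c : V) : ∀ (r : ℕ) (η : Fin r → E →L[ℝ] ℝ),
    wedgeConstL r η c = wedgeConst r η c
  | 0, _ => rfl
  | r + 1, η => by simp [wedgeConstL, wedgeConst, wedgeConstL_apply c r, wedgeL_apply]

/-- `wedgeOne` as a linear map in its last argument. -/
def wedgeOneL : ∀ r : ℕ, (Fin r → E →L[ℝ] ℝ) → (E →L[ℝ] V) →L[ℝ] E [⋀^Fin (r + 1)]→L[ℝ] V
  | 0, _ => (ContinuousAlternatingMap.ofSubsingletonLIE (𝕜 := ℝ) (E := E) (F := V)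
      (0 : Fin 1)).toContinuousLinearEquiv
  | r + 1, η => wedgeL E V (r + 1) (η 0) ∘L wedgeOneL r fun j => η j.succ

theorem wedgeOneL_apply (β : E →L[ℝ] V) : ∀ (r : ℕ) (η : Fin r → E →L[ℝ] ℝ),
    wedgeOneL r η β = wedgeOne r η β
  | 0, _ => rfl
  | r + 1, η => by simp [wedgeOneL, wedgeOne, wedgeOneL_apply β r, wedgeL_apply]

theorem wedgeConst_update_sum {κ : Type*} (s : Finset κ) (e : κ → E →L[ℝ] ℝ) (c : V) :
    ∀ (r : ℕ) (m : Fin r) (η : Fin r → E →L[ℝ] ℝ),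
    wedgeConst r (Function.update η m (∑ i ∈ s, e i)) c =
      ∑ i ∈ s, wedgeConst r (Function.update η m (e i)) c
  | r + 1, m, η => by
    simp only [wedgeConst, ← wedgeL_apply]
    refine Fin.cases ?_ (fun m => ?_) m
    · simp [map_sum, Function.update_of_ne, Fin.succ_ne_zero]
    · have h : ∀ t, (fun j : Fin r => Function.update η m.succ t j.succ) =
          Function.update (fun j => η j.succ) m t := fun t =>
        Function.update_comp_eq_of_injective η (Fin.succ_injective r) m t
      simp only [h, wedgeConst_update_sum s e c r, map_sum,
        Function.update_of_ne (Fin.succ_ne_zero m).symm]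

theorem wedgeOne_update_sum {κ : Type*} (s : Finset κ) (e : κ → E →L[ℝ] ℝ) (β : E →L[ℝ] V) :
    ∀ (r : ℕ) (m : Fin r) (η : Fin r → E →L[ℝ] ℝ),
    wedgeOne r (Function.update η m (∑ i ∈ s, e i)) β =
      ∑ i ∈ s, wedgeOne r (Function.update η m (e i)) β
  | r + 1, m, η => by
    simp only [wedgeOne, ← wedgeL_apply]
    refine Fin.cases ?_ (fun m => ?_) m
    · simp [map_sum, Function.update_of_ne, Fin.succ_ne_zero]
    · have h : ∀ t, (fun j : Fin r => Function.update η m.succ t j.succ) =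
          Function.update (fun j => η j.succ) m t := fun t =>
        Function.update_comp_eq_of_injective η (Fin.succ_injective r) m t
      simp only [h, wedgeOne_update_sum s e β r, map_sum,
        Function.update_of_ne (Fin.succ_ne_zero m).symm]

theorem wedgeConst_eq_zero {r : ℕ} {η : Fin r → E →L[ℝ] ℝ} {m : Fin r} (h : η m = 0) (c : V) :
    wedgeConst r η c = 0 := by
  rw [← Function.update_eq_self m η, h]
  exact wedgeConst_update_sum (∅ : Finset (Fin 0)) (fun _ => 0) c r m η

theorem wedgeOne_eq_zero {r : ℕ} {η : Fin r → E →L[ℝ] ℝ} {m : Fin r} (h : η m = 0)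
    (β : E →L[ℝ] V) : wedgeOne r η β = 0 := by
  rw [← Function.update_eq_self m η, h]
  exact wedgeOne_update_sum (∅ : Finset (Fin 0)) (fun _ => 0) β r m η

/-- Moving a linear form to the front:
`η₁ ∧ … ∧ η_r ∧ (ζ · c) = (-1)ʳ ζ ∧ η₁ ∧ … ∧ η_r · c`. -/
theorem wedgeOne_smulRight (ζ : E →L[ℝ] ℝ) (c : V) : ∀ (r : ℕ) (η : Fin r → E →L[ℝ] ℝ),
    wedgeOne r η (ζ.smulRight c) = (-1 : ℝ) ^ r • wedge ζ (wedgeConst r η c)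
  | 0, η => by
    ext v
    simp [wedgeOne, wedgeConst, wedge, ContinuousAlternatingMap.alternatizeUncurryFin_apply]
  | r + 1, η => by
    rw [wedgeOne, wedgeOne_smulRight ζ c r, wedgeConst, wedge_wedge_comm ζ (η 0), pow_succ,
      ← wedgeL_apply, map_smul, wedgeL_apply]
    simp

end WedgeAlgebra

/-! ### Exterior derivatives on a normed space -/

section NormedCalculus

variable {E : Type*} [NormedAddCommGroup E] [NormedSpace ℝ E]
  {V : Type*} [NormedAddCommGroup V] [NormedSpace ℝ V]

/-- The Leibniz rule `d(da ∧ θ) = -da ∧ dθ`. -/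
theorem extDeriv_wedge_fderiv {k : ℕ} {a : E → ℝ} {θ : E → E [⋀^Fin k]→L[ℝ] V} {x : E}
    (ha : ContDiffAt ℝ 2 a x) (hθ : DifferentiableAt ℝ θ x) :
    extDeriv (fun y => wedge (fderiv ℝ a y) (θ y)) x = -wedge (fderiv ℝ a x) (extDeriv θ x) := by
  have hda : DifferentiableAt ℝ (fderiv ℝ a) x :=
    (ha.fderiv_right (m := 1) (by norm_num)).differentiableAt (by norm_num)
  have hsymm : ∀ v w, fderiv ℝ (fderiv ℝ a) x v w = fderiv ℝ (fderiv ℝ a) x w v :=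
    ha.isSymmSndFDerivAt (by simp)
  have hd := ((wedgeL E V k).hasFDerivAt_of_bilinear hda.hasFDerivAt hθ.hasFDerivAt).fderiv
  -- the symmetric bilinear map whose double alternation compares the two sides
  set f : E →L[ℝ] E →L[ℝ] E [⋀^Fin k]→L[ℝ] V :=
    ((ContinuousLinearMap.smulRightL ℝ E (E [⋀^Fin k]→L[ℝ] V)).flip (θ x)) ∘L
        fderiv ℝ (fderiv ℝ a) x +
      ContinuousLinearMap.smulRightL ℝ E (E [⋀^Fin k]→L[ℝ] V) (fderiv ℝ a x) ∘L fderiv ℝ θ x +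
      (fderiv ℝ a x).smulRight (fderiv ℝ θ x) with hf
  have hf0 :=
    ContinuousAlternatingMap.alternatizeUncurryFin_alternatizeUncurryFinCLM_comp_of_symmetric
    (f := f) (fun v w => by
      change fderiv ℝ (fderiv ℝ a) x v w • θ x + fderiv ℝ a x w • fderiv ℝ θ x v +
          fderiv ℝ a x v • fderiv ℝ θ x w = fderiv ℝ (fderiv ℝ a) x w v • θ x +
          fderiv ℝ a x v • fderiv ℝ θ x w + fderiv ℝ a x w • fderiv ℝ θ x v
      rw [hsymm v w]
      abel)
  have hfe : (ContinuousAlternatingMap.alternatizeUncurryFinCLM ℝ E V).comp f =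
      fderiv ℝ (fun y => wedgeL E V k (fderiv ℝ a y) (θ y)) x +
        (fderiv ℝ a x).smulRight (extDeriv θ x) := by
    rw [hd]
    ext1 v
    simp only [hf, ContinuousLinearMap.comp_apply, add_apply, map_add,
      ContinuousLinearMap.smulRight_apply, map_smul]
    simp only [ContinuousLinearMap.precompL_apply]
    congr 1
    exact add_comm _ _
  rw [hfe, ContinuousAlternatingMap.alternatizeUncurryFin_add] at hf0
  exact eq_neg_of_add_eq_zero_left hf0

theorem contDiffAt_wedge {k : ℕ} {n : WithTop ℕ∞} {η : E → E →L[ℝ] ℝ}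
    {θ : E → E [⋀^Fin k]→L[ℝ] V} {x : E} (hη : ContDiffAt ℝ n η x) (hθ : ContDiffAt ℝ n θ x) :
    ContDiffAt ℝ n (fun y => wedge (η y) (θ y)) x :=
  ((wedgeL E V k).isBoundedBilinearMap.contDiff.contDiffAt (x := (η x, θ x))).comp
    (f := fun y => (η y, θ y)) x (hη.prodMk hθ)

theorem contDiffAt_wedgeConst {n : WithTop ℕ∞} {x : E} {b : E → V} (hb : ContDiffAt ℝ n b x) :
    ∀ (r : ℕ) {η : Fin r → E → E →L[ℝ] ℝ}, (∀ j, ContDiffAt ℝ n (η j) x) →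
      ContDiffAt ℝ n (fun y => wedgeConst r (fun j => η j y) (b y)) x
  | 0, _, _ => (ContinuousAlternatingMap.constOfIsEmptyLIE ℝ E V (Fin 0)).contDiff.contDiffAt.comp
      x hb
  | r + 1, _, hη => contDiffAt_wedge (hη 0) (contDiffAt_wedgeConst hb r fun j => hη j.succ)

theorem contDiffAt_wedgeOne {n : WithTop ℕ∞} {x : E} {β : E → E →L[ℝ] V}
    (hβ : ContDiffAt ℝ n β x) :
    ∀ (r : ℕ) {η : Fin r → E → E →L[ℝ] ℝ}, (∀ j, ContDiffAt ℝ n (η j) x) →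
      ContDiffAt ℝ n (fun y => wedgeOne r (fun j => η j y) (β y)) x
  | 0, _, _ => (ContinuousAlternatingMap.ofSubsingletonLIE (𝕜 := ℝ) (E := E) (F := V)
      (0 : Fin 1)).contDiff.contDiffAt.comp x hβ
  | r + 1, _, hη => contDiffAt_wedge (hη 0) (contDiffAt_wedgeOne hβ r fun j => hη j.succ)

/-- `d(da₁ ∧ … ∧ da_r · b) = (-1)ʳ da₁ ∧ … ∧ da_r ∧ db`. -/
theorem extDeriv_wedgeConst {x : E} {b : E → V} (hb : ContDiffAt ℝ 1 b x) :
    ∀ (r : ℕ) {a : Fin r → E → ℝ}, (∀ j, ContDiffAt ℝ 2 (a j) x) →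
      extDeriv (fun y => wedgeConst r (fun j => fderiv ℝ (a j) y) (b y)) x =
        (-1 : ℝ) ^ r • wedgeOne r (fun j => fderiv ℝ (a j) x) (fderiv ℝ b x)
  | 0, _, _ => by
    rw [pow_zero, one_smul]
    exact extDeriv_constOfIsEmpty b x
  | r + 1, a, ha => by
    have h := contDiffAt_wedgeConst hb r fun j =>
      (ha j.succ).fderiv_right (m := 1) (by norm_num)
    simp only [wedgeConst]
    rw [extDeriv_wedge_fderiv (ha 0) (h.differentiableAt (by norm_num)),
      extDeriv_wedgeConst hb r fun j => ha j.succ, wedgeOne, pow_succ, ← wedgeL_apply, map_smul,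
      wedgeL_apply]
    simp

/-- `d(da₁ ∧ … ∧ da_r ∧ db) = 0`. -/
theorem extDeriv_wedgeOne {x : E} {b : E → V} (hb : ContDiffAt ℝ 2 b x) :
    ∀ (r : ℕ) {a : Fin r → E → ℝ}, (∀ j, ContDiffAt ℝ 2 (a j) x) →
      extDeriv (fun y => wedgeOne r (fun j => fderiv ℝ (a j) y) (fderiv ℝ b y)) x = 0
  | 0, _, _ => by
    have h : extDeriv (extDeriv fun y =>
        ContinuousAlternatingMap.constOfIsEmpty ℝ E (Fin 0) (b y)) x = 0 :=
      extDeriv_extDeriv_apply (r := 2) ((ContinuousAlternatingMap.constOfIsEmptyLIE ℝ E V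
        (Fin 0)).contDiff.contDiffAt.comp x hb) (by simp)
    rw [funext (extDeriv_constOfIsEmpty b)] at h
    exact h
  | r + 1, a, ha => by
    have h := contDiffAt_wedgeOne (hb.fderiv_right (m := 1) (by norm_num)) r fun j =>
      (ha j.succ).fderiv_right (m := 1) (by norm_num)
    simp only [wedgeOne]
    rw [extDeriv_wedge_fderiv (ha 0) (h.differentiableAt (by norm_num)),
      extDeriv_wedgeOne hb r fun j => ha j.succ, ← wedgeL_apply, map_zero, neg_zero]

end NormedCalculus

/-! ### Local calculus of forms on a manifold -/

section Local

open Filter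
open scoped Topology

variable {E : Type*} [NormedAddCommGroup E] [NormedSpace ℝ E]
  {M : Type*} [TopologicalSpace M] [ChartedSpace E M]
  {V : Type*} [NormedAddCommGroup V] [NormedSpace ℝ V]

/-- The differential of a vector-valued function at `x`, as a linear map on `T_x M = E`. -/
def vdiff (f : M → V) (x : M) : E →L[ℝ] V := mvfderiv 𝓘(ℝ, E) f x

theorem two_le_infty : (2 : WithTop ℕ∞) ≤ ∞ := WithTop.coe_le_coe.2 (le_top : (2 : ℕ∞) ≤ ⊤)

/-- Smoothness of a form at a point, in all the preferred charts around it. -/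
def SmoothFormAt {k : ℕ} (θ : Form E M V k) (x : M) : Prop :=
  ∀ x₀ : M, x ∈ (extChartAt 𝓘(ℝ, E) x₀).source →
    ContDiffAt ℝ ∞ (inChart x₀ θ) (extChartAt 𝓘(ℝ, E) x₀ x)

theorem IsSmoothForm.of_forall {k : ℕ} {θ : Form E M V k} (h : ∀ x, SmoothFormAt θ x) :
    IsSmoothForm θ := fun x₀ y hy => by
  have h' := h _ x₀ ((extChartAt 𝓘(ℝ, E) x₀).map_target hy)
  rw [(extChartAt 𝓘(ℝ, E) x₀).right_inv hy] at h'
  exact h'.contDiffWithinAt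

theorem inChart_eventuallyEq {k : ℕ} {θ η : Form E M V k} {x x₀ : M} (h : θ =ᶠ[𝓝 x] η)
    (hx : x ∈ (extChartAt 𝓘(ℝ, E) x₀).source) :
    inChart x₀ θ =ᶠ[𝓝 (extChartAt 𝓘(ℝ, E) x₀ x)] inChart x₀ η := by
  have hc : Tendsto (extChartAt 𝓘(ℝ, E) x₀).symm (𝓝 (extChartAt 𝓘(ℝ, E) x₀ x)) (𝓝 x) := by
    have := continuousAt_extChartAt_symm' hx
    rwa [ContinuousAt, (extChartAt 𝓘(ℝ, E) x₀).left_inv hx] at this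
  filter_upwards [hc.eventually h] with y hy
  rw [inChart, inChart, hy]

theorem SmoothFormAt.congr {k : ℕ} {θ η : Form E M V k} {x : M} (hη : SmoothFormAt η x)
    (h : θ =ᶠ[𝓝 x] η) : SmoothFormAt θ x := fun x₀ hx =>
  (hη x₀ hx).congr_of_eventuallyEq (inChart_eventuallyEq h hx)

theorem extD_congr {k : ℕ} {θ η : Form E M V k} {x : M} (h : θ =ᶠ[𝓝 x] η) :
    extD θ x = extD η x := by
  rw [extD, extD, (inChart_eventuallyEq h (mem_extChartAt_source x)).extDeriv_eq]

theorem SmoothFormAt.smul {k : ℕ} {θ : Form E M V k} {x : M} (a : ℝ) (hθ : SmoothFormAt θ x) :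
    SmoothFormAt (a • θ) x := fun x₀ hx => by
  rw [inChart_smul]; exact (hθ x₀ hx).const_smul a

theorem SmoothFormAt.add {k : ℕ} {θ η : Form E M V k} {x : M} (hθ : SmoothFormAt θ x)
    (hη : SmoothFormAt η x) : SmoothFormAt (θ + η) x := fun x₀ hx => by
  rw [inChart_add]; exact (hθ x₀ hx).add (hη x₀ hx)

theorem SmoothFormAt.sum {κ : Type*} {k : ℕ} {θ : κ → Form E M V k} {x : M} (s : Finset κ)
    (h : ∀ i ∈ s, SmoothFormAt (θ i) x) : SmoothFormAt (∑ i ∈ s, θ i) x :=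
  Finset.sum_induction _ (SmoothFormAt · x) (fun _ _ => SmoothFormAt.add)
    (fun x₀ _ => by rw [inChart_zero]; exact contDiffAt_const) h

theorem SmoothFormAt.extD_add {k : ℕ} {θ η : Form E M V k} {x : M} (hθ : SmoothFormAt θ x)
    (hη : SmoothFormAt η x) : extD (θ + η) x = extD θ x + extD η x := by
  simp only [extD, inChart_add]
  rw [extDeriv_add ((hθ x (mem_extChartAt_source x)).differentiableAt (by simp))
    ((hη x (mem_extChartAt_source x)).differentiableAt (by simp))]
  ext v
  simp

theorem SmoothFormAt.extD_sum {κ : Type*} {k : ℕ} {θ : κ → Form E M V k} {x : M} (s : Finset κ)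
    (h : ∀ i ∈ s, SmoothFormAt (θ i) x) : extD (∑ i ∈ s, θ i) x = ∑ i ∈ s, extD (θ i) x := by
  classical
  induction s using Finset.induction_on with
  | empty => simp [extD_zero]
  | insert a s ha ih =>
    rw [Finset.sum_insert ha, Finset.sum_insert ha, SmoothFormAt.extD_add
      (h a (Finset.mem_insert_self a s))
      (SmoothFormAt.sum s fun i hi => h i (Finset.mem_insert_of_mem hi)),
      ih fun i hi => h i (Finset.mem_insert_of_mem hi)]

theorem eventually_mem_extChartAt_target {x x₀ : M} (hx : x ∈ (extChartAt 𝓘(ℝ, E) x₀).source) :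
    ∀ᶠ y in 𝓝 (extChartAt 𝓘(ℝ, E) x₀ x), y ∈ (extChartAt 𝓘(ℝ, E) x₀).target :=
  (isOpen_extChartAt_target x₀).mem_nhds ((extChartAt 𝓘(ℝ, E) x₀).map_source hx)

variable [IsManifold 𝓘(ℝ, E) ∞ M]

theorem mdifferentiableAt_extChartAt_symm {x₀ : M} {y : E}
    (hy : y ∈ (extChartAt 𝓘(ℝ, E) x₀).target) :
    MDifferentiableAt 𝓘(ℝ, E) 𝓘(ℝ, E) (extChartAt 𝓘(ℝ, E) x₀).symm y :=
  (((contMDiffOn_extChartAt_symm (n := ∞) x₀) y hy).contMDiffAt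
    ((isOpen_extChartAt_target x₀).mem_nhds hy)).mdifferentiableAt (by simp)

/-- The differential of a function in a chart is the derivative of its expression there. -/
theorem mvfderiv_comp_chartSymmDeriv {f : M → V} {x₀ : M} {y : E}
    (hy : y ∈ (extChartAt 𝓘(ℝ, E) x₀).target)
    (hf : MDifferentiableAt 𝓘(ℝ, E) 𝓘(ℝ, V) f ((extChartAt 𝓘(ℝ, E) x₀).symm y)) :
    vdiff (E := E) f ((extChartAt 𝓘(ℝ, E) x₀).symm y) ∘L chartSymmDeriv x₀ y =
      fderiv ℝ (f ∘ (extChartAt 𝓘(ℝ, E) x₀).symm) y := by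
  rw [← mfderiv_eq_fderiv]
  exact (mfderiv_comp y hf (mdifferentiableAt_extChartAt_symm hy)).symm

theorem fderiv_comp_chartDeriv {f : M → V} {x : M}
    (hf : MDifferentiableAt 𝓘(ℝ, E) 𝓘(ℝ, V) f x) :
    fderiv ℝ (f ∘ (extChartAt 𝓘(ℝ, E) x).symm) (extChartAt 𝓘(ℝ, E) x x) ∘L chartDeriv E x =
      vdiff (E := E) f x := by
  have hx := mem_extChartAt_source (I := 𝓘(ℝ, E)) x
  have h1 : MDifferentiableAt 𝓘(ℝ, E) 𝓘(ℝ, V) (f ∘ (extChartAt 𝓘(ℝ, E) x).symm)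
      (extChartAt 𝓘(ℝ, E) x x) := by
    refine MDifferentiableAt.comp _ ?_
      (mdifferentiableAt_extChartAt_symm ((extChartAt 𝓘(ℝ, E) x).map_source hx))
    rwa [(extChartAt 𝓘(ℝ, E) x).left_inv hx]
  have h2 : MDifferentiableAt 𝓘(ℝ, E) 𝓘(ℝ, E) (extChartAt 𝓘(ℝ, E) x) x :=
    (contMDiffAt_extChartAt (n := ∞)).mdifferentiableAt (by simp)
  rw [← mfderiv_eq_fderiv]
  refine (mfderiv_comp x h1 h2).symm.trans ?_
  have h3 : (f ∘ (extChartAt 𝓘(ℝ, E) x).symm) ∘ extChartAt 𝓘(ℝ, E) x =ᶠ[𝓝 x] f := by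
    filter_upwards [extChartAt_source_mem_nhds (I := 𝓘(ℝ, E)) x] with z hz
    exact congrArg f ((extChartAt 𝓘(ℝ, E) x).left_inv hz)
  exact h3.mfderiv_eq

theorem contDiffAt_comp_extChartAt_symm {f : M → V} {x x₀ : M} {n : ℕ∞}
    (hx : x ∈ (extChartAt 𝓘(ℝ, E) x₀).source) (hf : ContMDiffAt 𝓘(ℝ, E) 𝓘(ℝ, V) n f x) :
    ContDiffAt ℝ n (f ∘ (extChartAt 𝓘(ℝ, E) x₀).symm) (extChartAt 𝓘(ℝ, E) x₀ x) := by
  have hy := (extChartAt 𝓘(ℝ, E) x₀).map_source hx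
  have h : ContMDiffAt 𝓘(ℝ, E) 𝓘(ℝ, E) n (extChartAt 𝓘(ℝ, E) x₀).symm
      (extChartAt 𝓘(ℝ, E) x₀ x) :=
    (((contMDiffOn_extChartAt_symm (n := ∞) x₀) _ hy).contMDiffAt
      ((isOpen_extChartAt_target x₀).mem_nhds hy)).of_le (by exact_mod_cast le_top)
  rw [← contMDiffAt_iff_contDiffAt]
  refine ContMDiffAt.comp _ ?_ h
  rwa [(extChartAt 𝓘(ℝ, E) x₀).left_inv hx]

variable {r : ℕ} {a : Fin r → M → ℝ} {b : M → V} {x : M}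

theorem inChart_wedgeConst (ha : ∀ j, ContMDiff 𝓘(ℝ, E) 𝓘(ℝ, ℝ) ∞ (a j)) {x₀ : M} {y : E}
    (hy : y ∈ (extChartAt 𝓘(ℝ, E) x₀).target) :
    inChart x₀ (fun x => wedgeConst r (fun j => diff (E := E) (a j) x) (b x)) y =
      wedgeConst r (fun j => fderiv ℝ (a j ∘ (extChartAt 𝓘(ℝ, E) x₀).symm) y)
        ((b ∘ (extChartAt 𝓘(ℝ, E) x₀).symm) y) := by
  rw [inChart, wedgeConst_comp]
  congr 1
  funext j
  exact mvfderiv_comp_chartSymmDeriv hy ((ha j _).mdifferentiableAt (by simp))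

theorem inChart_wedgeOne (ha : ∀ j, ContMDiff 𝓘(ℝ, E) 𝓘(ℝ, ℝ) ∞ (a j)) {x₀ : M} {y : E}
    (hy : y ∈ (extChartAt 𝓘(ℝ, E) x₀).target)
    (hb : MDifferentiableAt 𝓘(ℝ, E) 𝓘(ℝ, V) b ((extChartAt 𝓘(ℝ, E) x₀).symm y)) :
    inChart x₀ (fun x => wedgeOne r (fun j => diff (E := E) (a j) x)
      (vdiff (E := E) b x)) y =
      wedgeOne r (fun j => fderiv ℝ (a j ∘ (extChartAt 𝓘(ℝ, E) x₀).symm) y)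
        (fderiv ℝ (b ∘ (extChartAt 𝓘(ℝ, E) x₀).symm) y) := by
  rw [inChart, wedgeOne_comp, mvfderiv_comp_chartSymmDeriv hy hb]
  congr 1
  funext j
  exact mvfderiv_comp_chartSymmDeriv hy ((ha j _).mdifferentiableAt (by simp))

theorem smoothFormAt_wedgeConst (ha : ∀ j, ContMDiff 𝓘(ℝ, E) 𝓘(ℝ, ℝ) ∞ (a j))
    (hb : ContMDiffAt 𝓘(ℝ, E) 𝓘(ℝ, V) ∞ b x) :
    SmoothFormAt (fun x => wedgeConst r (fun j => diff (E := E) (a j) x) (b x)) x :=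
  fun x₀ hx => by
    refine (contDiffAt_wedgeConst (contDiffAt_comp_extChartAt_symm hx hb) r fun j =>
      (contDiffAt_comp_extChartAt_symm hx (ha j x)).fderiv_right (m := ∞)
        (by simp)).congr_of_eventuallyEq ?_
    filter_upwards [eventually_mem_extChartAt_target hx] with y hy
    exact inChart_wedgeConst ha hy

/-- `d(da₁ ∧ … ∧ da_r · b) = (-1)ʳ da₁ ∧ … ∧ da_r ∧ db` on a manifold. -/
theorem extD_wedgeConst (ha : ∀ j, ContMDiff 𝓘(ℝ, E) 𝓘(ℝ, ℝ) ∞ (a j))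
    (hb : ContMDiffAt 𝓘(ℝ, E) 𝓘(ℝ, V) ∞ b x) :
    extD (fun x => wedgeConst r (fun j => diff (E := E) (a j) x) (b x)) x =
      (-1 : ℝ) ^ r • wedgeOne r (fun j => diff (E := E) (a j) x)
        (vdiff (E := E) b x) := by
  have hx := mem_extChartAt_source (I := 𝓘(ℝ, E)) x
  have h : inChart x (fun x => wedgeConst r (fun j => diff (E := E) (a j) x) (b x))
      =ᶠ[𝓝 (extChartAt 𝓘(ℝ, E) x x)] fun y =>
      wedgeConst r (fun j => fderiv ℝ (a j ∘ (extChartAt 𝓘(ℝ, E) x).symm) y)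
        ((b ∘ (extChartAt 𝓘(ℝ, E) x).symm) y) := by
    filter_upwards [eventually_mem_extChartAt_target hx] with y hy
    exact inChart_wedgeConst ha hy
  rw [extD, h.extDeriv_eq, extDeriv_wedgeConst
    ((contDiffAt_comp_extChartAt_symm hx hb).of_le (one_le_two.trans two_le_infty)) r fun j =>
    (contDiffAt_comp_extChartAt_symm hx (ha j x)).of_le two_le_infty]
  rw [← fderiv_comp_chartDeriv (hb.mdifferentiableAt (by simp))]
  have h2 : ∀ j, diff (E := E) (a j) x = _ := fun j =>
    (fderiv_comp_chartDeriv ((ha j x).mdifferentiableAt (by simp))).symm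
  simp only [h2]
  rw [← wedgeOne_comp]
  rfl

theorem inChart_wedgeOne_eventuallyEq (ha : ∀ j, ContMDiff 𝓘(ℝ, E) 𝓘(ℝ, ℝ) ∞ (a j))
    (hb : ∀ᶠ z in 𝓝 x, ContMDiffAt 𝓘(ℝ, E) 𝓘(ℝ, V) ∞ b z) {x₀ : M}
    (hx : x ∈ (extChartAt 𝓘(ℝ, E) x₀).source) :
    inChart x₀ (fun x => wedgeOne r (fun j => diff (E := E) (a j) x)
      (vdiff (E := E) b x)) =ᶠ[𝓝 (extChartAt 𝓘(ℝ, E) x₀ x)] fun y =>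
      wedgeOne r (fun j => fderiv ℝ (a j ∘ (extChartAt 𝓘(ℝ, E) x₀).symm) y)
        (fderiv ℝ (b ∘ (extChartAt 𝓘(ℝ, E) x₀).symm) y) := by
  have hc : Tendsto (extChartAt 𝓘(ℝ, E) x₀).symm (𝓝 (extChartAt 𝓘(ℝ, E) x₀ x)) (𝓝 x) := by
    have := continuousAt_extChartAt_symm' hx
    rwa [ContinuousAt, (extChartAt 𝓘(ℝ, E) x₀).left_inv hx] at this
  filter_upwards [eventually_mem_extChartAt_target hx, hc.eventually hb] with y hy hby
  exact inChart_wedgeOne ha hy (hby.mdifferentiableAt (by simp))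

theorem smoothFormAt_wedgeOne (ha : ∀ j, ContMDiff 𝓘(ℝ, E) 𝓘(ℝ, ℝ) ∞ (a j))
    (hb : ∀ᶠ z in 𝓝 x, ContMDiffAt 𝓘(ℝ, E) 𝓘(ℝ, V) ∞ b z) :
    SmoothFormAt (fun x => wedgeOne r (fun j => diff (E := E) (a j) x)
      (vdiff (E := E) b x)) x := fun x₀ hx =>
  (contDiffAt_wedgeOne ((contDiffAt_comp_extChartAt_symm hx hb.self_of_nhds).fderiv_right
    (m := ∞) (by simp)) r fun j =>
      (contDiffAt_comp_extChartAt_symm hx (ha j x)).fderiv_right (m := ∞)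
        (by simp)).congr_of_eventuallyEq (inChart_wedgeOne_eventuallyEq ha hb hx)

/-- `d(da₁ ∧ … ∧ da_r ∧ db) = 0` on a manifold. -/
theorem extD_wedgeOne (ha : ∀ j, ContMDiff 𝓘(ℝ, E) 𝓘(ℝ, ℝ) ∞ (a j))
    (hb : ∀ᶠ z in 𝓝 x, ContMDiffAt 𝓘(ℝ, E) 𝓘(ℝ, V) ∞ b z) :
    extD (fun x => wedgeOne r (fun j => diff (E := E) (a j) x)
      (vdiff (E := E) b x)) x = 0 := by
  have hx := mem_extChartAt_source (I := 𝓘(ℝ, E)) x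
  rw [extD, (inChart_wedgeOne_eventuallyEq ha hb hx).extDeriv_eq, extDeriv_wedgeOne
    ((contDiffAt_comp_extChartAt_symm hx hb.self_of_nhds).of_le two_le_infty) r
    fun j => (contDiffAt_comp_extChartAt_symm hx (ha j x)).of_le two_le_infty]
  rfl

end Local

/-! ### Alternating sums over Čech indices -/

section Algebra

variable {ι : Type*} [Fintype ι] {r : ℕ} {N B W : Type*} [AddCommGroup W] [Module ℝ W]

/-- If a summand does not see the index `L (m + 1)` except through the vector `η (L (m + 1))` in one
slot of `T`, and these vectors have sum zero, then the sum vanishes. -/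
theorem sum_face_eq_zero {η : ι → N} (T : (Fin r → N) → B → W) (m : Fin r)
    (hT : ∀ ξ b, ∑ i, T (Function.update ξ m (η i)) b = 0) (A : ι → ℝ) (b : (Fin r → ι) → B) :
    ∑ L : Fin (r + 1) → ι,
      A (L 0) • T (fun j => η (L j.succ)) (b (L ∘ m.succ.succAbove)) = 0 := by
  cases r with
  | zero => exact m.elim0
  | succ r =>
    rw [← (Fin.insertNthEquiv (fun _ => ι) m.succ).sum_comp, Fintype.sum_prod_type_right]
    refine Finset.sum_eq_zero fun K _ => ?_
    have h0 : ∀ i : ι, (m.succ.insertNth i K : Fin (r + 2) → ι) 0 = K 0 := fun i => by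
      have := Fin.insertNth_apply_succAbove (α := fun _ => ι) m.succ i K 0
      rwa [Fin.succ_succAbove_zero] at this
    have h1 : ∀ i : ι, (m.succ.insertNth i K : Fin (r + 2) → ι) ∘ m.succ.succAbove = K :=
      fun i => funext fun j => Fin.insertNth_apply_succAbove (α := fun _ => ι) m.succ i K j
    have h2 : ∀ i : ι,
        (fun j : Fin (r + 1) => η ((m.succ.insertNth i K : Fin (r + 2) → ι) j.succ)) =
        Function.update (fun j => η ((m.succ.insertNth (K 0) K : Fin (r + 2) → ι) j.succ)) m
          (η i) := fun i => by
      funext j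
      rcases eq_or_ne j m with rfl | hj
      · simp
      · obtain ⟨l, hl⟩ := Fin.exists_succAbove_eq (fun h => hj (Fin.succ_injective _ h))
        rw [Function.update_of_ne hj, ← hl, Fin.insertNth_apply_succAbove,
          Fin.insertNth_apply_succAbove]
    have h3 : ∀ i : ι, A ((m.succ.insertNth i K : Fin (r + 2) → ι) 0) •
        T (fun j => η ((m.succ.insertNth i K : Fin (r + 2) → ι) j.succ))
          (b ((m.succ.insertNth i K : Fin (r + 2) → ι) ∘ m.succ.succAbove)) = A (K 0) •
        T (Function.update (fun j => η ((m.succ.insertNth (K 0) K : Fin (r + 2) → ι) j.succ)) m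
          (η i)) (b K) := fun i => by rw [h0, h1, h2]
    refine (Finset.sum_congr rfl fun i _ => h3 i).trans ?_
    rw [← Finset.smul_sum, hT, smul_zero]

/-- Weighting an alternating sum of faces by `A (J 0)` and by a multilinear expression in the
`η (J j)`, `j ≥ 1`, only the face that omits the index `0` survives, provided that `∑ A = 1` and
`∑ η = 0`. -/
theorem sum_weighted_coboundary [AddCommGroup B] {η : ι → N} (T : (Fin r → N) → B →+ W)
    (hT : ∀ m ξ b, ∑ i, T (Function.update ξ m (η i)) b = 0) {A : ι → ℝ} (hA : ∑ i, A i = 1)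
    (b : (Fin r → ι) → B) :
    ∑ J : Fin (r + 1) → ι, A (J 0) • T (fun j => η (J j.succ))
      (∑ m : Fin (r + 1), (-1 : ℤ) ^ (m : ℕ) • b (J ∘ m.succAbove)) =
    ∑ K : Fin r → ι, T (fun j => η (K j)) (b K) := by
  simp only [map_sum, map_zsmul, Finset.smul_sum]
  rw [Finset.sum_comm, Fin.sum_univ_succ, Finset.sum_eq_zero (s := Finset.univ (α := Fin r)),
    add_zero]
  · rw [← (Fin.consEquiv (fun _ => ι)).sum_comp, Fintype.sum_prod_type_right]
    refine Finset.sum_congr rfl fun K _ => ?_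
    simp [Fin.consEquiv, ← Finset.sum_smul, hA]
  · intro m _
    simp only [smul_comm (_ : ℝ) (_ : ℤ)]
    rw [← Finset.smul_sum, sum_face_eq_zero (fun ξ b => T ξ b) m (hT m), smul_zero]

end Algebra

/-! ### The form associated to a Čech cochain -/

section CochainForm

open Filter
open scoped Topology

variable {E : Type*} [NormedAddCommGroup E] [NormedSpace ℝ E]
  {M : Type*} [TopologicalSpace M] [ChartedSpace E M]
  {V : Type*} [NormedAddCommGroup V] [NormedSpace ℝ V]

theorem vdiff_congr {f g : M → V} {x : M} (h : f =ᶠ[𝓝 x] g) :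
    vdiff (E := E) f x = vdiff (E := E) g x := by
  rw [vdiff, vdiff, mvfderiv, mvfderiv, h.mfderiv_eq]; rfl

theorem vdiff_const (v : V) (x : M) : vdiff (E := E) (fun _ : M => v) x = 0 :=
  mvfderiv_const v

theorem vdiff_smul {a : M → ℝ} {f : M → V} {x : M}
    (ha : MDifferentiableAt 𝓘(ℝ, E) 𝓘(ℝ, ℝ) a x) (hf : MDifferentiableAt 𝓘(ℝ, E) 𝓘(ℝ, V) f x) :
    vdiff (E := E) (fun z => a z • f z) x =
      a x • vdiff (E := E) f x + (diff (E := E) a x).smulRight (f x) :=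
  mvfderiv_smul ha hf

theorem vdiff_const_smul (a : ℝ) {f : M → V} {x : M}
    (hf : MDifferentiableAt 𝓘(ℝ, E) 𝓘(ℝ, V) f x) :
    vdiff (E := E) (fun z => a • f z) x = a • vdiff (E := E) f x := by
  rw [vdiff_smul (mdifferentiableAt_const (c := a)) hf]
  have h : diff (E := E) (fun _ : M => a) x = 0 := vdiff_const a x
  rw [h]
  ext v
  simp

theorem mdifferentiableAt_sum {κ : Type*} (s : Finset κ) {f : κ → M → V} {x : M}
    (hf : ∀ i ∈ s, MDifferentiableAt 𝓘(ℝ, E) 𝓘(ℝ, V) (f i) x) :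
    MDifferentiableAt 𝓘(ℝ, E) 𝓘(ℝ, V) (fun z => ∑ i ∈ s, f i z) x := by
  classical
  induction s using Finset.induction_on with
  | empty => simpa using mdifferentiableAt_const
  | insert a s ha ih =>
    simp only [Finset.sum_insert ha]
    exact (hf a (Finset.mem_insert_self a s)).add
      (ih fun i hi => hf i (Finset.mem_insert_of_mem hi))

theorem vdiff_sum {κ : Type*} (s : Finset κ) {f : κ → M → V} {x : M}
    (hf : ∀ i ∈ s, MDifferentiableAt 𝓘(ℝ, E) 𝓘(ℝ, V) (f i) x) :
    vdiff (E := E) (fun z => ∑ i ∈ s, f i z) x = ∑ i ∈ s, vdiff (E := E) (f i) x := by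
  classical
  induction s using Finset.induction_on with
  | empty => simpa using vdiff_const (0 : V) x
  | insert a s ha ih =>
    have hf' : ∀ i ∈ s, MDifferentiableAt 𝓘(ℝ, E) 𝓘(ℝ, V) (f i) x := fun i hi =>
      hf i (Finset.mem_insert_of_mem hi)
    simp only [Finset.sum_insert ha]
    rw [← ih hf']
    exact mvfderiv_add (hf a (Finset.mem_insert_self a s)) (mdifferentiableAt_sum s hf')

theorem extZero_apply {X A : Type*} [TopologicalSpace X] [Zero A] {W : Opens X} (f : W → A)
    (x : W) : extZero f (x : X) = f x := by
  simp [extZero]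

theorem extZero_of_notMem {X A : Type*} [TopologicalSpace X] [Zero A] {W : Opens X} (f : W → A)
    {x : X} (hx : x ∉ W) : extZero f x = 0 := by
  simp [extZero, hx]

theorem contMDiffAt_extZero {W : Opens M} {f : W → V} (hf : ContMDiff 𝓘(ℝ, E) 𝓘(ℝ, V) ∞ f) {x : M}
    (hx : x ∈ W) : ContMDiffAt 𝓘(ℝ, E) 𝓘(ℝ, V) ∞ (extZero f) x := by
  refine (contMDiffAt_subtype_iff (x := ⟨x, hx⟩)).1 ?_
  simpa only [extZero_apply] using hf ⟨x, hx⟩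

variable {ι : Type*} {U : ι → Opens M} {α : SmoothPartitionOfUnity ι 𝓘(ℝ, E) M}

theorem partition_eventuallyEq_zero (hα : α.IsSubordinate fun i => (U i : Set M))
    {i : ι} {x : M} (hx : x ∉ U i) : (α i : M → ℝ) =ᶠ[𝓝 x] fun _ => 0 :=
  notMem_tsupport_iff_eventuallyEq.1 fun h => hx (hα i h)

theorem diff_partition_eventuallyEq_zero (hα : α.IsSubordinate fun i => (U i : Set M))
    {i : ι} {x : M} (hx : x ∉ U i) : diff (E := E) (α i) =ᶠ[𝓝 x] fun _ => 0 := by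
  filter_upwards [(partition_eventuallyEq_zero hα hx).eventuallyEq_nhds] with z hz
  exact (vdiff_congr hz).trans (vdiff_const 0 z)

theorem mem_inter {X ι : Type*} [TopologicalSpace X] {U : ι → Opens X} {k : ℕ} {J : Fin k → ι}
    {x : X} : x ∈ inter U J ↔ ∀ m, x ∈ U (J m) := Set.mem_iInter

/-- Outside `U_{i₀…i_r}` the coefficient `α_{i₀} dα_{i₁} ∧ … ∧ dα_{i_r}` vanishes. -/
theorem smul_wedgeConst_eq_zero (hα : α.IsSubordinate fun i => (U i : Set M)) {r : ℕ}
    {J : Fin (r + 1) → ι} {x : M} (hx : x ∉ inter U J) : ∀ᶠ z in 𝓝 x, ∀ v : V,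
    α (J 0) z • wedgeConst (E := E) r (fun j => diff (E := E) (α (J j.succ)) z) v = 0 := by
  obtain ⟨m, hm⟩ := not_forall.1 fun h => hx (mem_inter.2 h)
  revert hm
  refine Fin.cases (fun hm => ?_) (fun m hm => ?_) m
  · filter_upwards [partition_eventuallyEq_zero hα hm] with z hz v
    rw [hz, zero_smul]
  · filter_upwards [diff_partition_eventuallyEq_zero hα hm] with z hz v
    rw [wedgeConst_eq_zero (m := m) hz, smul_zero]

theorem smul_wedgeOne_eq_zero (hα : α.IsSubordinate fun i => (U i : Set M)) {r : ℕ}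
    {J : Fin (r + 1) → ι} {x : M} (hx : x ∉ inter U J) (β : E →L[ℝ] V) :
    α (J 0) x • wedgeOne (E := E) r (fun j => diff (E := E) (α (J j.succ)) x) β = 0 := by
  obtain ⟨m, hm⟩ := not_forall.1 fun h => hx (mem_inter.2 h)
  revert hm
  refine Fin.cases (fun hm => ?_) (fun m hm => ?_) m
  · rw [(partition_eventuallyEq_zero hα hm).self_of_nhds, zero_smul]
  · rw [wedgeOne_eq_zero (m := m) (diff_partition_eventuallyEq_zero hα hm).self_of_nhds, smul_zero]

theorem extZero_cobd {X ι G : Type*} [TopologicalSpace X] [AddCommGroup G] {U : ι → Opens X}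
    {F : FunPresheaf X G} {r : ℕ} (c : Cochain F U r) {J : Fin (r + 2) → ι}
    {x : X} (hx : x ∈ inter U J) : extZero (cobd F U r c J).1 x =
      ∑ m : Fin (r + 2), (-1 : ℤ) ^ (m : ℕ) • extZero (c (J ∘ m.succAbove)).1 x := by
  rw [extZero_apply _ (⟨x, hx⟩ : inter U J)]
  simp only [cobd, AddMonoidHom.coe_mk, ZeroHom.coe_mk, AddSubgroup.val_finsetSum,
    AddSubgroup.coe_zsmul, Finset.sum_apply, Pi.smul_apply]
  refine Finset.sum_congr rfl fun m _ => ?_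
  rw [extZero_apply _ (⟨x, inter_le_face U J m hx⟩ : inter U (J ∘ m.succAbove))]
  rfl

open Classical in
/-- The function `α_{i₀} c_{i₀…i_r}` if `x₀ ∈ U_{i₀…i_r}`, and `0` otherwise. Near `x₀` it is
smooth, and it may serve as the coefficient of `dα_{i₁} ∧ … ∧ dα_{i_r}` in `cochainForm`. -/
def localCoeff (α : SmoothPartitionOfUnity ι 𝓘(ℝ, E) M) {F : FunPresheaf M V} {r : ℕ}
    (c : Cochain F U r) (x₀ : M) (J : Fin (r + 1) → ι) (x : M) : V :=
  if x₀ ∈ inter U J then α (J 0) x • extZero (c J).1 x else 0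

theorem contMDiffAt_localCoeff {F : FunPresheaf M V} {r : ℕ} {c : Cochain F U r}
    (hc : ∀ J, ContMDiff 𝓘(ℝ, E) 𝓘(ℝ, V) ∞ (c J).1) (x₀ : M) (J : Fin (r + 1) → ι) :
    ∀ᶠ z in 𝓝 x₀, ContMDiffAt 𝓘(ℝ, E) 𝓘(ℝ, V) ∞ (localCoeff α c x₀ J) z := by
  by_cases hx : x₀ ∈ inter U J
  · have h : localCoeff α c x₀ J = fun z => α (J 0) z • extZero (c J).1 z :=
      funext fun z => if_pos hx
    filter_upwards [(inter U J).2.mem_nhds hx] with z hz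
    rw [h]
    exact ((α (J 0)).contMDiff z).smul (contMDiffAt_extZero (hc J) hz)
  · have h : localCoeff α c x₀ J = fun z => 0 := funext fun z => if_neg hx
    rw [h]
    exact Eventually.of_forall fun z => contMDiffAt_const

variable [Fintype ι]

variable (U α) in
/-- The form `∑ α_{i₀} dα_{i₁} ∧ … ∧ dα_{i_r} · c_{i₀…i_r}` associated to a Čech cochain with
coefficients in any sheaf of vector-valued functions; it generalises `cechForm`, the case of locally
constant functions. -/
def cochainForm {F : FunPresheaf M V} {r : ℕ} (c : Cochain F U r) : Form E M V r := fun x =>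
  ∑ J : Fin (r + 1) → ι,
    α (J 0) x • wedgeConst (E := E) r (fun j => diff (E := E) (α (J j.succ)) x) (extZero (c J).1 x)

variable (α) in
/-- The form `∑ α_{i₀} dα_{i₁} ∧ … ∧ dα_{i_r} ∧ β_{i₀…i_r}` at the point `x`, for a family of
linear forms `β` on `T_x M`. -/
def cochainOneForm {r : ℕ} (x : M) (β : (Fin (r + 1) → ι) → E →L[ℝ] V) :
    E [⋀^Fin (r + 1)]→L[ℝ] V :=
  ∑ J : Fin (r + 1) → ι,
    α (J 0) x • wedgeOne (E := E) r (fun j => diff (E := E) (α (J j.succ)) x) (β J)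

theorem sum_partition (x : M) : ∑ i, α i x = 1 := by
  rw [← finsum_eq_sum_of_fintype]
  exact α.sum_eq_one (Set.mem_univ x)

theorem sum_diff_partition (x : M) : ∑ i, diff (E := E) (α i) x = 0 := by
  have h := vdiff_sum (E := E) Finset.univ (f := fun i => (α i : M → ℝ)) (x := x)
    fun i _ => ((α i).contMDiff x).mdifferentiableAt (by simp)
  simp only [sum_partition] at h
  rw [vdiff_const] at h
  exact h.symm

theorem sum_wedgeConst_partition {r : ℕ} (x : M) (m : Fin r) (ξ : Fin r → E →L[ℝ] ℝ) (v : V) :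
    ∑ i, wedgeConstL r (Function.update ξ m (diff (E := E) (α i) x)) v = 0 := by
  simp only [wedgeConstL_apply]
  rw [← wedgeConst_update_sum, sum_diff_partition, wedgeConst_eq_zero (m := m) (by simp)]

theorem sum_wedgeOne_partition {r : ℕ} (x : M) (m : Fin r) (ξ : Fin r → E →L[ℝ] ℝ)
    (β : E →L[ℝ] V) :
    ∑ i, wedgeOneL r (Function.update ξ m (diff (E := E) (α i) x)) β = 0 := by
  simp only [wedgeOneL_apply]
  rw [← wedgeOne_update_sum, sum_diff_partition, wedgeOne_eq_zero (m := m) (by simp)]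

/-- In the form of a coboundary only the faces that omit `i₀` contribute:
`∑ α_{i₀} dα_{i₁} ∧ … ∧ dα_{i_{r+1}} (∂c)_{i₀…i_{r+1}} = ∑ dα_{i₀} ∧ … ∧ dα_{i_r} c_{i₀…i_r}`. -/
theorem cochainForm_cobd (hα : α.IsSubordinate fun i => (U i : Set M)) {F : FunPresheaf M V} {r : ℕ}
    (c : Cochain F U r) (x : M) : cochainForm U α (cobd F U r c) x =
      ∑ J : Fin (r + 1) → ι,
        wedgeConst (E := E) (r + 1) (fun j => diff (E := E) (α (J j)) x) (extZero (c J).1 x) := by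
  have h := sum_weighted_coboundary (η := fun i => diff (E := E) (α i) x)
    (fun ξ => (wedgeConstL (V := V) (r + 1) ξ : V →+ E [⋀^Fin (r + 1)]→L[ℝ] V))
    (sum_wedgeConst_partition x) (sum_partition (α := α) x) fun J => extZero (c J).1 x
  simp only [AddMonoidHom.coe_coe, wedgeConstL_apply] at h
  rw [← h]
  refine Finset.sum_congr rfl fun J _ => ?_
  by_cases hx : x ∈ inter U J
  · rw [extZero_cobd c hx]
  · rw [(smul_wedgeConst_eq_zero hα hx).self_of_nhds, (smul_wedgeConst_eq_zero hα hx).self_of_nhds]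

/-- If `β` is a Čech cocycle at `x`, then `∑ α_{i₀} dα_{i₁} ∧ … ∧ dα_{i_r} ∧ β_{i₀…i_r}` equals
`∑ dα_{i₁} ∧ … ∧ dα_{i_r} ∧ β_{i₀i₁…i_r}` for each fixed `i₀` with `x ∈ U_{i₀}`. -/
theorem cochainOneForm_eq_of_cocycle (hα : α.IsSubordinate fun i => (U i : Set M)) {r : ℕ} {x : M}
    {β : (Fin (r + 1) → ι) → E →L[ℝ] V} (hβ : ∀ J : Fin (r + 2) → ι, x ∈ inter U J →
      ∑ m : Fin (r + 2), (-1 : ℤ) ^ (m : ℕ) • β (J ∘ m.succAbove) = 0) {i₀ : ι} (hi₀ : x ∈ U i₀) :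
    cochainOneForm α x β =
      ∑ K : Fin r → ι, wedgeOne r (fun j => diff (E := E) (α (K j)) x) (β (Fin.cons i₀ K)) := by
  have h := sum_weighted_coboundary (η := fun i => diff (E := E) (α i) x)
    (fun ξ => (wedgeOneL (V := V) r ξ : (E →L[ℝ] V) →+ E [⋀^Fin (r + 1)]→L[ℝ] V))
    (sum_wedgeOne_partition x) (sum_partition (α := α) x) fun K => β (Fin.cons i₀ K)
  simp only [AddMonoidHom.coe_coe, wedgeOneL_apply] at h
  rw [← h, cochainOneForm]
  refine Finset.sum_congr rfl fun J _ => ?_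
  by_cases hx : x ∈ inter U J
  · have h1 := hβ (Fin.cons i₀ J) (mem_inter.2 (Fin.cases hi₀ (mem_inter.1 hx)))
    rw [Fin.sum_univ_succ] at h1
    have h2 : (Fin.cons i₀ J : Fin (r + 2) → ι) ∘ (0 : Fin (r + 2)).succAbove = J := by
      funext j; simp
    have h3 : ∀ m : Fin (r + 1), (Fin.cons i₀ J : Fin (r + 2) → ι) ∘ m.succ.succAbove =
        Fin.cons i₀ (J ∘ m.succAbove) := fun m => by
      funext j
      refine Fin.cases ?_ (fun j => ?_) j
      · simp
      · simp [Fin.succ_succAbove_succ]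
    simp only [h2, h3, Fin.val_zero, pow_zero, one_smul, Fin.val_succ, pow_succ, mul_neg, mul_one,
      neg_smul, Finset.sum_neg_distrib] at h1
    rw [← sub_eq_zero.1 ((sub_eq_add_neg _ _).trans h1)]
  · rw [smul_wedgeOne_eq_zero hα hx, smul_wedgeOne_eq_zero hα hx]

theorem cochainForm_eventuallyEq (hα : α.IsSubordinate fun i => (U i : Set M))
    {F : FunPresheaf M V} {r : ℕ} (c : Cochain F U r) (x₀ : M) :
    cochainForm U α c =ᶠ[𝓝 x₀] ∑ J : Fin (r + 1) → ι, fun x =>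
      wedgeConst (E := E) r (fun j => diff (E := E) (α (J j.succ)) x) (localCoeff α c x₀ J x) := by
  have h : ∀ᶠ z in 𝓝 x₀, ∀ J : Fin (r + 1) → ι, x₀ ∉ inter U J → ∀ v : V,
      α (J 0) z • wedgeConst (E := E) r (fun j => diff (E := E) (α (J j.succ)) z) v = 0 :=
    eventually_all.2 fun J => by
      by_cases hJ : x₀ ∈ inter U J
      · exact Eventually.of_forall fun z h => absurd hJ h
      · exact (smul_wedgeConst_eq_zero hα hJ).mono fun z hz _ => hz
  filter_upwards [h] with z hz
  rw [cochainForm, Finset.sum_apply]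
  refine Finset.sum_congr rfl fun J _ => ?_
  by_cases hJ : x₀ ∈ inter U J
  · rw [localCoeff, if_pos hJ, ← wedgeConstL_apply, ← wedgeConstL_apply, map_smul]
  · rw [hz J hJ, localCoeff, if_neg hJ, ← wedgeConstL_apply, map_zero]

variable [IsManifold 𝓘(ℝ, E) ∞ M]

theorem isSmoothForm_cochainForm (hα : α.IsSubordinate fun i => (U i : Set M))
    {F : FunPresheaf M V} {r : ℕ} {c : Cochain F U r}
    (hc : ∀ J, ContMDiff 𝓘(ℝ, E) 𝓘(ℝ, V) ∞ (c J).1) : IsSmoothForm (cochainForm U α c) :=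
  IsSmoothForm.of_forall fun x => (SmoothFormAt.sum _ fun J _ => smoothFormAt_wedgeConst
    (fun j => (α (J j.succ)).contMDiff) (contMDiffAt_localCoeff hc x J).self_of_nhds).congr
    (cochainForm_eventuallyEq hα c x)

theorem extD_cochainForm_eventuallyEq (hα : α.IsSubordinate fun i => (U i : Set M))
    {F : FunPresheaf M V} {r : ℕ} {c : Cochain F U r}
    (hc : ∀ J, ContMDiff 𝓘(ℝ, E) 𝓘(ℝ, V) ∞ (c J).1) (x₀ : M) :
    extD (cochainForm U α c) =ᶠ[𝓝 x₀] (-1 : ℝ) ^ r • ∑ J : Fin (r + 1) → ι, fun x =>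
      wedgeOne (E := E) r (fun j => diff (E := E) (α (J j.succ)) x)
        (vdiff (E := E) (localCoeff α c x₀ J) x) := by
  filter_upwards [(cochainForm_eventuallyEq hα c x₀).eventuallyEq_nhds,
    eventually_all.2 (contMDiffAt_localCoeff (α := α) hc x₀)] with z hz hcz
  rw [extD_congr hz, SmoothFormAt.extD_sum _ fun J _ => smoothFormAt_wedgeConst
    (fun j => (α (J j.succ)).contMDiff) (hcz J), Pi.smul_apply, Finset.sum_apply, Finset.smul_sum]
  exact Finset.sum_congr rfl fun J _ =>
    extD_wedgeConst (fun j => (α (J j.succ)).contMDiff) (hcz J)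

/-- The exterior derivative of the form of a smooth cochain is smooth and closed. -/
theorem extD_cochainForm_mem_closedForms (hα : α.IsSubordinate fun i => (U i : Set M))
    {F : FunPresheaf M V} {r : ℕ} {c : Cochain F U r}
    (hc : ∀ J, ContMDiff 𝓘(ℝ, E) 𝓘(ℝ, V) ∞ (c J).1) :
    extD (cochainForm U α c) ∈ closedForms E M V (r + 1) := by
  set η : M → (Fin (r + 1) → ι) → Form E M V (r + 1) := fun x₀ J x =>
    wedgeOne (E := E) r (fun j => diff (E := E) (α (J j.succ)) x)
      (vdiff (E := E) (localCoeff α c x₀ J) x) with hη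
  have hd : ∀ x, extD (cochainForm U α c) =ᶠ[𝓝 x] (-1 : ℝ) ^ r • ∑ J, η x J :=
    extD_cochainForm_eventuallyEq hα hc
  have hs : ∀ x, ∀ J ∈ Finset.univ, SmoothFormAt (η x J) x := fun x J _ =>
    smoothFormAt_wedgeOne (fun j => (α (J j.succ)).contMDiff) (contMDiffAt_localCoeff hc x J)
  have h0 : ∀ x, ∀ J ∈ Finset.univ, extD (η x J) x = 0 := fun x J _ =>
    extD_wedgeOne (fun j => (α (J j.succ)).contMDiff) (contMDiffAt_localCoeff hc x J)
  refine ⟨IsSmoothForm.of_forall fun x => ((SmoothFormAt.sum _ (hs x)).smul _).congr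
    (hd x), funext fun x => ?_⟩
  rw [extD_congr (hd x), extD_smul, Pi.smul_apply, SmoothFormAt.extD_sum _ (hs x),
    Finset.sum_eq_zero (h0 x), smul_zero]
  rfl

/-- The exterior derivative of the form of a smooth cochain `c`: with `f` denoting the form of a
cochain, `d f(c) = f(∂c) + (-1)ʳ ∑ α_{i₀} dα_{i₁} ∧ … ∧ dα_{i_r} ∧ dc_{i₀…i_r}`. -/
theorem extD_cochainForm (hα : α.IsSubordinate fun i => (U i : Set M))
    {F : FunPresheaf M V} {r : ℕ} {c : Cochain F U r}
    (hc : ∀ J, ContMDiff 𝓘(ℝ, E) 𝓘(ℝ, V) ∞ (c J).1) (x : M) :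
    extD (cochainForm U α c) x = cochainForm U α (cobd F U r c) x +
      (-1 : ℝ) ^ r • cochainOneForm α x fun J => vdiff (E := E) (extZero (c J).1) x := by
  rw [(extD_cochainForm_eventuallyEq hα hc x).self_of_nhds, cochainForm_cobd hα, cochainOneForm,
    Pi.smul_apply, Finset.sum_apply, Finset.smul_sum, Finset.smul_sum, ← Finset.sum_add_distrib]
  refine Finset.sum_congr rfl fun J _ => ?_
  by_cases hJ : x ∈ inter U J
  · have h : localCoeff α c x J = fun z => α (J 0) z • extZero (c J).1 z :=
      funext fun z => if_pos hJ
    rw [h, vdiff_smul (((α (J 0)).contMDiff x).mdifferentiableAt (by simp))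
      ((contMDiffAt_extZero (hc J) hJ).mdifferentiableAt (by simp)), ← wedgeOneL_apply, map_add,
      map_smul, wedgeOneL_apply, wedgeOneL_apply, wedgeOne_smulRight, smul_add,
      smul_smul ((-1 : ℝ) ^ r) ((-1 : ℝ) ^ r), ← mul_pow, neg_one_mul, neg_neg, one_pow, one_smul]
    exact add_comm _ _
  · have h : localCoeff α c x J = fun z => 0 := funext fun z => if_neg hJ
    rw [h, vdiff_const, ← wedgeOneL_apply, map_zero, smul_wedgeOne_eq_zero hα hJ,
      extZero_of_notMem _ hJ, ← wedgeConstL_apply, map_zero, smul_zero, add_zero]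

end CochainForm

/-! ### The Čech complex -/

section CechComplex

variable {X : Type*} [TopologicalSpace X] {G : Type*} [AddCommGroup G] {ι : Type*}

theorem cobd_apply {F : FunPresheaf X G} {U : ι → Opens X} {r : ℕ} (c : Cochain F U r)
    (J : Fin (r + 2) → ι) (x : inter U J) : (cobd F U r c J).1 x =
      ∑ m : Fin (r + 2), (-1 : ℤ) ^ (m : ℕ) •
        (c (J ∘ m.succAbove)).1 ⟨x, inter_le_face U J m x.2⟩ := by
  simp only [cobd, AddMonoidHom.coe_mk, ZeroHom.coe_mk, AddSubgroup.val_finsetSum,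
    AddSubgroup.coe_zsmul, Finset.sum_apply, Pi.smul_apply]
  rfl

/-- The alternating sum over pairs of removed indices vanishes, since removing the same two indices
in the other order changes the sign. -/
theorem sum_sum_face_face {r : ℕ} (J : Fin (r + 2) → ι) (g : (Fin r → ι) → G) :
    ∑ m : Fin (r + 2), (-1 : ℤ) ^ (m : ℕ) • ∑ n : Fin (r + 1), (-1 : ℤ) ^ (n : ℕ) •
      g ((J ∘ m.succAbove) ∘ n.succAbove) = 0 := by
  simp only [Finset.smul_sum, smul_smul, ← pow_add]
  rw [← Fintype.sum_prod_type' (f := fun (m : Fin (r + 2)) (n : Fin (r + 1)) =>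
    (-1 : ℤ) ^ ((m : ℕ) + n) • g ((J ∘ m.succAbove) ∘ n.succAbove))]
  refine Finset.sum_involution (fun p _ => (p.1.succAbove p.2, p.2.predAbove p.1)) ?_ ?_ ?_ ?_
  · rintro ⟨m, n⟩ -
    have h : (J ∘ (m.succAbove n).succAbove) ∘ (n.predAbove m).succAbove =
        (J ∘ m.succAbove) ∘ n.succAbove := by
      funext k
      simp [Fin.succAbove_succAbove_succAbove_predAbove]
    simp only [h, Fin.neg_one_pow_succAbove_add_predAbove, neg_smul, add_neg_cancel]
  · rintro ⟨m, n⟩ - - h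
    exact Fin.succAbove_ne m n (congrArg Prod.fst h)
  · exact fun _ _ => Finset.mem_univ _
  · rintro ⟨m, n⟩ -
    simp [Fin.succAbove_succAbove_predAbove, Fin.predAbove_predAbove_succAbove]

theorem cobd_cobd {F : FunPresheaf X G} {U : ι → Opens X} {r : ℕ} (c : Cochain F U r) :
    cobd F U (r + 1) (cobd F U r c) = 0 := by
  funext J
  refine Subtype.ext (funext fun x => ?_)
  simp only [cobd_apply]
  -- the values at `x` of the sections, which are indexed by the faces of `J`, form one function
  have h := sum_sum_face_face J fun K => extZero (c K).1 (x : X)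
  refine Eq.trans (Finset.sum_congr rfl fun m _ => congrArg _ (Finset.sum_congr rfl fun n _ =>
    congrArg _ ?_)) h
  exact (extZero_apply _ (⟨x, inter_le_face U _ n (inter_le_face U J m x.2)⟩ :
    inter U ((J ∘ m.succAbove) ∘ n.succAbove))).symm

end CechComplex

/-! ### Logarithms of circle-valued functions -/

section Logarithm

variable {E : Type*} [NormedAddCommGroup E] [NormedSpace ℝ E]
  {N : Type*} [TopologicalSpace N] [ChartedSpace E N]

attribute [local instance] finrank_real_complex_fact' in
theorem contMDiff_circle_coe : ContMDiff (𝓡 1) 𝓘(ℝ, ℂ) ∞ (fun z : Circle => (z : ℂ)) :=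
  contMDiff_coe_sphere (E := ℂ)

/-- A continuous logarithm of a smooth circle-valued function is smooth: near `x₀` it equals
`u x₀ + Im log (l / l x₀)`. -/
theorem contMDiff_of_circleExp {u : N → ℝ} (hu : Continuous u)
    (hl : ContMDiff 𝓘(ℝ, E) (𝓡 1) ∞ fun x => Circle.exp (u x)) : ContMDiff 𝓘(ℝ, E) 𝓘(ℝ, ℝ) ∞ u := by
  intro x₀
  have hl' : ContMDiffAt 𝓘(ℝ, E) 𝓘(ℝ, ℂ) ∞ (fun x => (Circle.exp (u x) : ℂ)) x₀ :=
    (contMDiff_circle_coe.comp hl) x₀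
  set g : ℂ → ℝ := fun z => u x₀ + (Complex.log (z * Complex.exp (-(u x₀ * Complex.I)))).im with hg
  have hgs : ContDiffAt ℝ ∞ g (Circle.exp (u x₀) : ℂ) := by
    have h1 : (Circle.exp (u x₀) : ℂ) * Complex.exp (-(u x₀ * Complex.I)) = 1 := by
      rw [Circle.coe_exp, ← Complex.exp_add, add_neg_cancel, Complex.exp_zero]
    have h2 : ContDiffAt ℝ ∞ Complex.log
        ((Circle.exp (u x₀) : ℂ) * Complex.exp (-(u x₀ * Complex.I))) := by
      rw [h1]
      exact (Complex.contDiffAt_log (by simp)).restrict_scalars ℝ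
    have h3 : ContDiffAt ℝ ∞ (fun z : ℂ => z * Complex.exp (-(u x₀ * Complex.I)))
        (Circle.exp (u x₀) : ℂ) := contDiffAt_id.mul contDiffAt_const
    have h4 : ContDiffAt ℝ ∞
        (Complex.log ∘ fun z : ℂ => z * Complex.exp (-(u x₀ * Complex.I)))
        (Circle.exp (u x₀) : ℂ) :=
      ContDiffAt.comp _ h2 h3
    exact contDiffAt_const.add (Complex.imCLM.contDiff.contDiffAt.comp _ h4)
  refine (ContMDiffAt.comp x₀ (g := g) hgs.contMDiffAt hl').congr_of_eventuallyEq ?_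
  have hnear : ∀ᶠ x in nhds x₀, u x - u x₀ ∈ Set.Ioo (-Real.pi) Real.pi := by
    refine (hu.sub continuous_const).continuousAt.eventually_mem (Ioo_mem_nhds ?_ ?_) <;>
      simp [Real.pi_pos]
  filter_upwards [hnear] with x hx
  have h4 : (Circle.exp (u x) : ℂ) * Complex.exp (-(u x₀ * Complex.I)) =
      Complex.exp (((u x - u x₀ : ℝ) : ℂ) * Complex.I) := by
    rw [Circle.coe_exp, ← Complex.exp_add]
    congr 1
    push_cast
    ring
  have h5 : (((u x - u x₀ : ℝ) : ℂ) * Complex.I).im = u x - u x₀ := by simp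
  simp only [hg, Function.comp_apply]
  rw [h4, Complex.log_exp (by rw [h5]; exact hx.1) (by rw [h5]; exact hx.2.le), h5]
  ring

/-- The isomorphism `t ↦ it` from `ℝ` to `iℝ`. -/
def mulI : ℝ →L[ℝ] ImLine :=
  (ContinuousLinearMap.smulRight (1 : ℝ →L[ℝ] ℝ) Complex.I).codRestrict ImLine fun t => by simp

theorem expIm_mulI (t : ℝ) : expIm (mulI t) = Additive.ofMul (Circle.exp t) := by
  simp [expIm, mulI]

/-- A smooth circle-valued function on a simply connected manifold lifts through the covering
`iℝ → S¹`. -/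
theorem exists_smooth_log [SimplyConnectedSpace N] {l : N → Circle}
    (hl : ContMDiff 𝓘(ℝ, E) (𝓡 1) ∞ l) :
    ∃ u : N → ImLine, ContMDiff 𝓘(ℝ, E) 𝓘(ℝ, ImLine) ∞ u ∧ ∀ x, (expIm (u x)).toMul = l x := by
  have : LocallyPathConnectedSpace N := ChartedSpace.locallyPathConnectedSpace E N
  obtain ⟨x₀⟩ : Nonempty N := inferInstance
  obtain ⟨t, ht⟩ := Circle.exp_surjective (l x₀)
  obtain ⟨u, ⟨-, hu⟩, -⟩ := Circle.isCoveringMap_exp.existsUnique_continuousMap_lifts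
    ⟨l, hl.continuous⟩ x₀ t ht
  have hu' : ∀ x, Circle.exp (u x) = l x := fun x => congrFun hu x
  refine ⟨fun x => mulI (u x), mulI.contDiff.contMDiff.comp
    (contMDiff_of_circleExp u.continuous (by simpa only [hu'] using hl)), fun x => ?_⟩
  rw [expIm_mulI, toMul_ofMul, hu']

theorem expIm_eq_zero {z : ImLine} (hz : expIm z = 0) : z ∈ TwoPiIZ := by
  have h : Circle.exp (z : ℂ).im = 1 := congrArg Additive.toMul hz
  obtain ⟨n, hn⟩ := Circle.exp_eq_one.1 h
  refine AddSubgroup.mem_zmultiples_iff.2 ⟨n, Subtype.ext ?_⟩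
  rw [ImLine.eq_im_mul_I z, hn]
  simp [twoPiI]
  ring

instance : DiscreteTopology TwoPiIZ := by
  let _ : NormedSpace ℚ ImLine := NormedSpace.restrictScalars ℚ ℝ ImLine
  exact NormedSpace.discreteTopology_zmultiples twoPiI

end Logarithm

/-! ### The connecting homomorphism -/

section Connecting

variable {E : Type*} [NormedAddCommGroup E] [NormedSpace ℝ E]
  {M : Type*} [TopologicalSpace M] [ChartedSpace E M] {ι : Type*} {U : ι → Opens M} {r : ℕ}

theorem exists_isLogarithm (hU : IsGoodCover U) (l : Cochain (smoothCircle E M) U r) :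
    ∃ u : Cochain (smoothIm E M) U r, IsLogarithm U u l := by
  have h : ∀ J : Fin (r + 1) → ι, ∃ u : inter U J → ImLine,
      ContMDiff 𝓘(ℝ, E) 𝓘(ℝ, ImLine) ∞ u ∧ ∀ x, (expIm (u x)).toMul = ((l J).1 x).toMul := by
    intro J
    by_cases hJ : (inter U J : Set M).Nonempty
    · have : ContractibleSpace (inter U J) := hU.contractible r J hJ
      have : SimplyConnectedSpace (inter U J) := .ofContractible _
      exact exists_smooth_log (l J).2
    · exact ⟨0, contMDiff_const, fun x => absurd ⟨x, x.2⟩ hJ⟩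
  choose u hu hul using h
  exact ⟨fun J => ⟨u J, hu J⟩, hul⟩

theorem IsLogarithm.sub {u u' : Cochain (smoothIm E M) U r} {l l' : Cochain (smoothCircle E M) U r}
    (h : IsLogarithm U u l) (h' : IsLogarithm U u' l') : IsLogarithm U (u - u') (l - l') :=
  fun J x => by
    have h1 : expIm ((u J).1 x - (u' J).1 x) = (l J).1 x - (l' J).1 x := by
      rw [map_sub, h J x, h' J x]
    exact h1

theorem IsLogarithm.cobd {u : Cochain (smoothIm E M) U r} {l : Cochain (smoothCircle E M) U r}
    (h : IsLogarithm U u l) : IsLogarithm U (cobd _ U r u) (cobd _ U r l) := fun J x => by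
  rw [cobd_apply, cobd_apply, map_sum]
  exact Finset.sum_congr rfl fun m _ => by rw [map_zsmul, h]

/-- The smooth cochain `v` takes its values in `2πiℤ`, and is there the cochain `c`. -/
def IsPeriod (c : Cochain (locConst M TwoPiIZ) U r) (v : Cochain (smoothIm E M) U r) : Prop :=
  ∀ J x, (((c J).1 x : TwoPiIZ) : ImLine) = (v J).1 x

theorem exists_isPeriod {v : Cochain (smoothIm E M) U r} (hv : IsLogarithm U v 0) :
    ∃ c, IsPeriod c v :=
  ⟨fun J => ⟨fun x => ⟨(v J).1 x, expIm_eq_zero (hv J x)⟩, by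
    have h : ContMDiff 𝓘(ℝ, E) 𝓘(ℝ, ImLine) ∞ (v J).1 := (v J).2
    exact IsLocallyConstant.iff_continuous _ |>.2 (h.continuous.subtype_mk _)⟩, fun _ _ => rfl⟩

theorem IsPeriod.sub {c c' : Cochain (locConst M TwoPiIZ) U r} {v v' : Cochain (smoothIm E M) U r}
    (h : IsPeriod c v) (h' : IsPeriod c' v') : IsPeriod (c - c') (v - v') := fun J x => by
  have h1 : (((c J).1 x : TwoPiIZ) : ImLine) - ((c' J).1 x : TwoPiIZ) =
      (v J).1 x - (v' J).1 x := by rw [h J x, h' J x]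
  exact h1

theorem IsPeriod.cobd {c : Cochain (locConst M TwoPiIZ) U r} {v : Cochain (smoothIm E M) U r}
    (h : IsPeriod c v) : IsPeriod (cobd _ U r c) (cobd _ U r v) := fun J x => by
  rw [cobd_apply, cobd_apply, AddSubgroup.val_finsetSum]
  exact Finset.sum_congr rfl fun m _ => by rw [AddSubgroup.coe_zsmul, h]

theorem IsPeriod.unique {c c' : Cochain (locConst M TwoPiIZ) U r} {v : Cochain (smoothIm E M) U r}
    (h : IsPeriod c v) (h' : IsPeriod c' v) : c = c' := by
  funext J
  exact Subtype.ext (funext fun x => Subtype.ext ((h J x).trans (h' J x).symm))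

theorem IsLogarithm.exists_isPeriod_cobd {u : Cochain (smoothIm E M) U r}
    {l : Cochain (smoothCircle E M) U r} (h : IsLogarithm U u l)
    (hl : l ∈ cocycles (smoothCircle E M) U r) :
    ∃ c : cocycles (locConst M TwoPiIZ) U (r + 1), IsPeriod c.1 (CechDeRham.cobd _ U r u) := by
  have h1 := h.cobd
  rw [show CechDeRham.cobd _ U r l = 0 from hl] at h1
  obtain ⟨c, hc⟩ := exists_isPeriod h1
  refine ⟨⟨c, ?_⟩, hc⟩
  have h2 := hc.cobd
  rw [cobd_cobd] at h2
  exact h2.unique fun J x => rfl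

/-- The coboundary of a logarithm of a coboundary is a coboundary over `2πiℤ`: it is the coboundary
of the difference of that logarithm and the coboundary of a logarithm. -/
theorem IsLogarithm.mem_coboundaries (hU : IsGoodCover U) {u : Cochain (smoothIm E M) U r}
    {l : Cochain (smoothCircle E M) U r} (h : IsLogarithm U u l)
    (hl : l ∈ coboundaries (smoothCircle E M) U r) {c : Cochain (locConst M TwoPiIZ) U (r + 1)}
    (hc : IsPeriod c (CechDeRham.cobd _ U r u)) :
    c ∈ coboundaries (locConst M TwoPiIZ) U (r + 1) := by
  obtain ⟨v, hv, hvu⟩ : ∃ v : Cochain (smoothIm E M) U r, IsLogarithm U v 0 ∧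
      CechDeRham.cobd _ U r v = CechDeRham.cobd _ U r u := by
    cases r with
    | zero =>
      rw [show l = 0 from hl] at h
      exact ⟨u, h, rfl⟩
    | succ r =>
      obtain ⟨l', rfl⟩ := hl
      obtain ⟨u', hu'⟩ := exists_isLogarithm hU l'
      refine ⟨u - CechDeRham.cobd _ U r u', ?_, ?_⟩
      · simpa using h.sub hu'.cobd
      · rw [map_sub, cobd_cobd, sub_zero]
  obtain ⟨w, hw⟩ := exists_isPeriod hv
  have h1 := hw.cobd
  rw [hvu] at h1
  exact ⟨w, h1.unique hc⟩

/-- The connecting homomorphism of the exponential sequence exists. -/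
theorem exists_isConnectingHom (hU : IsGoodCover U) (r : ℕ) :
    ∃ δ : CechH (smoothCircle E M) U r →+ CechH (locConst M TwoPiIZ) U (r + 1),
      IsConnectingHom U δ := by
  choose u hu using fun l : cocycles (smoothCircle E M) U r => exists_isLogarithm hU l.1
  choose c hc using fun l : cocycles (smoothCircle E M) U r => (hu l).exists_isPeriod_cobd l.2
  -- the class of `∂v` depends only on the class of `e^v`
  have key : ∀ (l : cocycles (smoothCircle E M) U r) (v : Cochain (smoothIm E M) U r)
      (l' : Cochain (smoothCircle E M) U r) (d : cocycles (locConst M TwoPiIZ) U (r + 1)),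
      IsLogarithm U v l' → IsPeriod d.1 (cobd _ U r v) →
      l.1 - l' ∈ coboundaries (smoothCircle E M) U r → CechH.mk (c l) = CechH.mk d := by
    intro l v l' d hv hd hl
    have h1 := (hc l).sub hd
    rw [← map_sub] at h1
    have h2 := ((hu l).sub hv).mem_coboundaries hU hl h1
    refine QuotientAddGroup.eq.2 (AddSubgroup.mem_addSubgroupOf.2 ?_)
    have h3 := neg_mem h2
    rwa [neg_sub, sub_eq_neg_add] at h3
  let δ₀ : cocycles (smoothCircle E M) U r →+ CechH (locConst M TwoPiIZ) U (r + 1) :=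
    AddMonoidHom.mk' (fun l => CechH.mk (c l)) fun l l' => by
      refine key (l + l') (u l + u l') (l.1 + l'.1) (c l + c l') (fun J x => ?_) (fun J x => ?_)
        (by simp)
      · have h1 : expIm ((u l J).1 x + (u l' J).1 x) = (l.1 J).1 x + (l'.1 J).1 x := by
          rw [map_add, hu l J x, hu l' J x]
        exact h1
      · rw [map_add]
        have h1 : ((((c l).1 J).1 x : TwoPiIZ) : ImLine) + (((c l').1 J).1 x : TwoPiIZ) =
            (cobd _ U r (u l) J).1 x + (cobd _ U r (u l') J).1 x := by
          rw [hc l J x, hc l' J x]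
        exact h1
  refine ⟨QuotientAddGroup.lift _ δ₀ fun l hl => ?_, fun l => ⟨⟨u l, hu l⟩, fun v hv => ?_⟩⟩
  · refine (QuotientAddGroup.eq_zero_iff _).2 (AddSubgroup.mem_addSubgroupOf.2 ?_)
    exact (hu l).mem_coboundaries hU (AddSubgroup.mem_addSubgroupOf.1 hl) (hc l)
  · obtain ⟨d, hd⟩ := hv.exists_isPeriod_cobd l.2
    exact ⟨d, hd, key l v l.1 d hv hd (by simp)⟩

end Connecting

/-! ### The map from Čech to de Rham cohomology -/

section CechDeRhamMap

open Filter
open scoped Topology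

variable {E : Type*} [NormedAddCommGroup E] [NormedSpace ℝ E]
  {M : Type*} [TopologicalSpace M] [ChartedSpace E M]
  {V : Type*} [NormedAddCommGroup V] [NormedSpace ℝ V] {ι : Type*} {U : ι → Opens M} {r : ℕ}

theorem contMDiff_of_isLocallyConstant {W : Opens M} {f : W → V} (hf : IsLocallyConstant f) :
    ContMDiff 𝓘(ℝ, E) 𝓘(ℝ, V) ∞ f := fun x =>
  contMDiffAt_const.congr_of_eventuallyEq (hf.eventually_eq x)

theorem vdiff_extZero_of_isLocallyConstant {W : Opens M} {f : W → V} (hf : IsLocallyConstant f)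
    {x : M} (hx : x ∈ W) : vdiff (E := E) (extZero f) x = 0 := by
  refine (vdiff_congr ?_).trans (vdiff_const (f ⟨x, hx⟩) x)
  have h := hf.eventually_eq ⟨x, hx⟩
  rw [nhds_subtype_eq_comap, eventually_comap] at h
  filter_upwards [h, W.2.mem_nhds hx] with z hz hzW
  rw [extZero_apply f ⟨z, hzW⟩]
  exact hz ⟨z, hzW⟩ rfl

variable [Fintype ι] {α : SmoothPartitionOfUnity ι 𝓘(ℝ, E) M}

theorem cechForm_add (c c' : Cochain (locConst M V) U r) :
    cechForm U α (c + c') = cechForm U α c + cechForm U α c' := by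
  funext x
  simp only [cechForm, Pi.add_apply]
  rw [← Finset.sum_add_distrib]
  refine Finset.sum_congr rfl fun J _ => ?_
  have h : extZero ((c + c') J).1 x = extZero (c J).1 x + extZero (c' J).1 x := by
    by_cases hx : x ∈ inter U J
    · simp [extZero, hx]
    · simp [extZero, hx]
  have h' : extZero (c J + c' J).1 x = extZero (c J).1 x + extZero (c' J).1 x := h
  rw [h', ← wedgeConstL_apply, map_add, smul_add, wedgeConstL_apply, wedgeConstL_apply]

theorem cechForm_zero : cechForm U α (0 : Cochain (locConst M V) U r) = 0 := by
  have h := cechForm_add (α := α) (0 : Cochain (locConst M V) U r) 0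
  rwa [add_zero, left_eq_add] at h

variable [IsManifold 𝓘(ℝ, E) ∞ M]

theorem isSmoothForm_cechForm (hα : α.IsSubordinate fun i => (U i : Set M))
    (c : Cochain (locConst M V) U r) : IsSmoothForm (cechForm U α c) :=
  isSmoothForm_cochainForm hα fun J => contMDiff_of_isLocallyConstant (c J).2

/-- The map from Čech cochains to forms commutes with the differentials. -/
theorem extD_cechForm (hα : α.IsSubordinate fun i => (U i : Set M))
    (c : Cochain (locConst M V) U r) : extD (cechForm U α c) = cechForm U α (cobd _ U r c) := by
  funext x
  refine (extD_cochainForm hα (fun J => contMDiff_of_isLocallyConstant (c J).2) x).trans ?_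
  have h : cochainOneForm α x (fun J => vdiff (E := E) (extZero (c J).1) x) = 0 := by
    refine Finset.sum_eq_zero fun J _ => ?_
    by_cases hx : x ∈ inter U J
    · rw [show (fun J => vdiff (E := E) (extZero (c J).1) x) J = 0 from
        vdiff_extZero_of_isLocallyConstant (c J).2 hx, ← wedgeOneL_apply, map_zero, smul_zero]
    · exact smul_wedgeOne_eq_zero hα hx _
  rw [h, smul_zero, add_zero]
  rfl

theorem cechForm_mem_closedForms (hα : α.IsSubordinate fun i => (U i : Set M))
    {c : Cochain (locConst M V) U r} (hc : c ∈ cocycles (locConst M V) U r) :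
    cechForm U α c ∈ closedForms E M V r :=
  ⟨isSmoothForm_cechForm hα c, by
    rw [extD_cechForm hα, show cobd _ U r c = 0 from hc, cechForm_zero]⟩

theorem cechForm_mem_exactForms (hα : α.IsSubordinate fun i => (U i : Set M))
    {c : Cochain (locConst M V) U r} (hc : c ∈ coboundaries (locConst M V) U r) :
    cechForm U α c ∈ exactForms E M V r := by
  cases r with
  | zero =>
    rw [show c = 0 from hc, cechForm_zero]
    exact zero_mem _
  | succ r =>
    obtain ⟨b, rfl⟩ := hc
    exact ⟨cechForm U α b, isSmoothForm_cechForm hα b, extD_cechForm hα b⟩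

theorem exists_isCechDeRhamMap (hα : α.IsSubordinate fun i => (U i : Set M)) (r : ℕ) :
    ∃ Φ : CechH (locConst M V) U r →+ DeRhamH E M V r, IsCechDeRhamMap U α Φ := by
  let Φ₀ : cocycles (locConst M V) U r →+ DeRhamH E M V r :=
    AddMonoidHom.mk' (fun c => DeRhamH.mk ⟨cechForm U α c.1, cechForm_mem_closedForms hα c.2⟩)
      fun c c' => congrArg DeRhamH.mk (Subtype.ext (cechForm_add c.1 c'.1))
  refine ⟨QuotientAddGroup.lift _ Φ₀ fun c hc => ?_, fun c =>
    ⟨cechForm_mem_closedForms hα c.2, rfl⟩⟩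
  exact (Submodule.Quotient.mk_eq_zero _).2
    (cechForm_mem_exactForms hα (AddSubgroup.mem_addSubgroupOf.1 hc))

end CechDeRhamMap

/-! ### The form of a circle-valued cocycle -/

section CircleCocycle

open Filter
open scoped Topology

variable {E : Type*} [NormedAddCommGroup E] [NormedSpace ℝ E]
  {M : Type*} [TopologicalSpace M] [ChartedSpace E M] {ι : Type*} {U : ι → Opens M} {r : ℕ}

theorem vdiff_comp {V W : Type*} [NormedAddCommGroup V] [NormedSpace ℝ V] [NormedAddCommGroup W]
    [NormedSpace ℝ W] {f : M → V} {g : V → W} {g' : V →L[ℝ] W} {x : M}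
    (hg : HasFDerivAt g g' (f x)) (hf : MDifferentiableAt 𝓘(ℝ, E) 𝓘(ℝ, V) f x) :
    vdiff (E := E) (fun z => g (f z)) x = g' ∘L vdiff (E := E) f x :=
  (hg.hasMFDerivAt.comp x hf.hasMFDerivAt).mfderiv

/-- The logarithmic differential of a circle-valued function is the differential of a logarithm. -/
theorem IsLogarithm.logDiff_eq {u : Cochain (smoothIm E M) U r} {l : Cochain (smoothCircle E M) U r}
    (h : IsLogarithm U u l) {J : Fin (r + 1) → ι} {x : M} (hx : x ∈ inter U J) :
    logDiff (E := E) (l J).1 x = vdiff (E := E) (extZero (u J).1) x := by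
  have hu : MDifferentiableAt 𝓘(ℝ, E) 𝓘(ℝ, ImLine) (extZero (u J).1) x :=
    (contMDiffAt_extZero (u J).2 hx).mdifferentiableAt (by simp)
  have hl : ∀ y : inter U J, ((((l J).1 y).toMul : Circle) : ℂ) = Complex.exp ((u J).1 y : ℂ) :=
    fun y => by rw [← coe_expIm, h J y]
  have h1 : diffCircle (E := E) (l J).1 x =
      vdiff (E := E) (fun z => Complex.exp ((extZero (u J).1 z : ImLine) : ℂ)) x := by
    refine vdiff_congr ?_
    filter_upwards [(inter U J).2.mem_nhds hx] with z hz
    rw [extZero_apply _ (⟨z, hz⟩ : inter U J), extZero_apply _ (⟨z, hz⟩ : inter U J), hl]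
  have h2 : HasFDerivAt (fun z : ImLine => Complex.exp (z : ℂ))
      (Complex.exp ((extZero (u J).1 x : ImLine) : ℂ) • ImLine.subtypeL) (extZero (u J).1 x) :=
    (ImLine.subtypeL.hasFDerivAt (x := extZero (u J).1 x)).cexp
  rw [vdiff_comp h2 hu] at h1
  have h3 : extZero (u J).1 x = (u J).1 ⟨x, hx⟩ := extZero_apply _ (⟨x, hx⟩ : inter U J)
  ext v
  simp only [logDiff, dif_pos hx]
  rw [ContinuousLinearMap.coe_codRestrict_apply, smul_apply, h1, hl, h3]
  simp [Complex.exp_ne_zero]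

theorem neg_one_pow_zsmul {W : Type*} [AddCommGroup W] [Module ℝ W] (m : ℕ) (w : W) :
    (-1 : ℤ) ^ m • w = (-1 : ℝ) ^ m • w := by
  rw [← Int.cast_smul_eq_zsmul ℝ]
  push_cast
  rfl

/-- The differentials of a cochain with locally constant coboundary form a Čech cocycle. -/
theorem cobd_vdiff_eq_zero {u : Cochain (smoothIm E M) U r}
    {c : Cochain (locConst M TwoPiIZ) U (r + 1)} (hc : IsPeriod c (cobd _ U r u))
    {J : Fin (r + 2) → ι} {x : M} (hx : x ∈ inter U J) :
    ∑ m : Fin (r + 2), (-1 : ℤ) ^ (m : ℕ) • vdiff (E := E) (extZero (u (J ∘ m.succAbove)).1) x =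
      0 := by
  have hu : ∀ m : Fin (r + 2),
      MDifferentiableAt 𝓘(ℝ, E) 𝓘(ℝ, ImLine) (extZero (u (J ∘ m.succAbove)).1) x := fun m =>
    (contMDiffAt_extZero (u _).2 (inter_le_face U J m hx)).mdifferentiableAt (by simp)
  have h0 : vdiff (E := E) (extZero (cobd _ U r u J).1) x = 0 := by
    refine vdiff_extZero_of_isLocallyConstant ?_ hx
    rw [← funext (hc J)]
    exact (c J).2.comp _
  have h1 : extZero (cobd _ U r u J).1 =ᶠ[𝓝 x] fun z => ∑ m : Fin (r + 2),
      (-1 : ℝ) ^ (m : ℕ) • extZero (u (J ∘ m.succAbove)).1 z := by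
    filter_upwards [(inter U J).2.mem_nhds hx] with z hz
    rw [extZero_cobd u hz]
    simp only [neg_one_pow_zsmul]
  have h2 := vdiff_sum (E := E) (x := x) Finset.univ
    (f := fun (m : Fin (r + 2)) z => (-1 : ℝ) ^ (m : ℕ) • extZero (u (J ∘ m.succAbove)).1 z)
    fun m _ => mdifferentiableAt_const.smul (hu m)
  rw [← h0, vdiff_congr h1]
  refine Eq.trans (Finset.sum_congr rfl fun m _ => ?_) h2.symm
  rw [vdiff_const_smul _ (hu m), neg_one_pow_zsmul]

variable [Fintype ι] {α : SmoothPartitionOfUnity ι 𝓘(ℝ, E) M}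

theorem cechForm_mapCochain {u : Cochain (smoothIm E M) U r}
    {c : Cochain (locConst M TwoPiIZ) U r} (hc : IsPeriod c u) :
    cechForm U α (mapCochain TwoPiIZ.subtype U r c) = cochainForm U α u := by
  funext x
  refine Finset.sum_congr rfl fun J _ => ?_
  have h : ((mapCochain TwoPiIZ.subtype U r c) J).1 = (u J).1 := funext (hc J)
  rw [h]

variable [IsManifold 𝓘(ℝ, E) ∞ M]

/-- If `u` is a logarithm of the cocycle `l`, with `f` denoting the form of a cochain, then
`f(∂u) - d f(u)` is given on `U_{i₀}` by the logarithmic differentials of the `l_{i₀i₁…i_r}`. -/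
theorem cochainForm_cobd_sub_extD (hα : α.IsSubordinate fun i => (U i : Set M))
    {u : Cochain (smoothIm E M) U r} {l : Cochain (smoothCircle E M) U r} (h : IsLogarithm U u l)
    {c : Cochain (locConst M TwoPiIZ) U (r + 1)} (hc : IsPeriod c (cobd _ U r u)) {i₀ : ι} {x : M}
    (hx : x ∈ U i₀) :
    cochainForm U α (cobd _ U r u) x - extD (cochainForm U α u) x =
      (-1 : ℝ) ^ (r + 1) • ∑ K : Fin r → ι, wedgeOne r (fun j => diff (E := E) (α (K j)) x)
        (logDiff (E := E) (l (Fin.cons i₀ K)).1 x) := by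
  have h1 := cochainOneForm_eq_of_cocycle hα
    (β := fun J => vdiff (E := E) (extZero (u J).1) x) (fun J hJ => cobd_vdiff_eq_zero hc hJ) hx
  rw [extD_cochainForm hα (fun J => (u J).2), sub_add_cancel_left, pow_succ, mul_neg_one, neg_smul,
    h1]
  refine congrArg (fun θ => -((-1 : ℝ) ^ r • θ)) (Finset.sum_congr rfl fun K _ => ?_)
  by_cases hK : x ∈ inter U (Fin.cons i₀ K : Fin (r + 1) → ι)
  · rw [h.logDiff_eq hK]
  · obtain ⟨j, hj⟩ : ∃ j, x ∉ U (K j) := not_forall.1 fun hK' =>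
      hK (mem_inter.2 (Fin.cases hx hK'))
    have hj' := (diff_partition_eventuallyEq_zero hα hj).self_of_nhds
    rw [wedgeOne_eq_zero (m := j) hj', wedgeOne_eq_zero (m := j) hj']

end CircleCocycle

end CechDeRham

end

theorem mainTheorem10
    {E : Type*} [NormedAddCommGroup E] [NormedSpace ℝ E] [FiniteDimensional ℝ E]
    {M : Type*} [TopologicalSpace M] [T2Space M] [SecondCountableTopology M]
    [ChartedSpace E M] [IsManifold 𝓘(ℝ, E) ∞ M]
    {ι : Type*} [Fintype ι] (U : ι → TopologicalSpace.Opens M) (hU : CechDeRham.IsGoodCover U)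
    (α : SmoothPartitionOfUnity ι 𝓘(ℝ, E) M) (hα : α.IsSubordinate fun i => (U i : Set M))
    (r : ℕ) :
    ∃ (δ : CechDeRham.CechH (CechDeRham.smoothCircle E M) U r →+
          CechDeRham.CechH (CechDeRham.locConst M CechDeRham.TwoPiIZ) U (r + 1))
      (Φ : CechDeRham.CechH (CechDeRham.locConst M CechDeRham.ImLine) U (r + 1) →+
          CechDeRham.DeRhamH E M CechDeRham.ImLine (r + 1)),
      CechDeRham.IsConnectingHom U δ ∧ CechDeRham.IsCechDeRhamMap U α Φ ∧
      ∀ l : CechDeRham.cocycles (CechDeRham.smoothCircle E M) U r,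
        ∃ θ : CechDeRham.closedForms E M CechDeRham.ImLine (r + 1),
          (∀ i₀, ∀ x ∈ U i₀, θ.1 x = (-1 : ℝ) ^ (r + 1) • ∑ K : Fin r → ι,
            CechDeRham.wedgeOne r (fun j => CechDeRham.diff (α (K j)) x)
              (CechDeRham.logDiff (l.1 (Fin.cons i₀ K)).1 x)) ∧
          Φ (CechDeRham.mapCechH CechDeRham.TwoPiIZ.subtype U (r + 1)
            (δ (CechDeRham.CechH.mk l))) = CechDeRham.DeRhamH.mk θ := by
  obtain ⟨δ, hδ⟩ := CechDeRham.exists_isConnectingHom (E := E) hU r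
  obtain ⟨Φ, hΦ⟩ := CechDeRham.exists_isCechDeRhamMap (V := CechDeRham.ImLine) hα (r + 1)
  refine ⟨δ, Φ, hδ, hΦ, fun l => ?_⟩
  obtain ⟨⟨u, hu⟩, hper⟩ := hδ l
  obtain ⟨c, hc, hδc⟩ := hper u hu
  have hmap := CechDeRham.mapCochain_mem_cocycles CechDeRham.TwoPiIZ.subtype U (r + 1) c.2
  obtain ⟨hf, hΦc⟩ := hΦ ⟨_, hmap⟩
  have hd := CechDeRham.extD_cochainForm_mem_closedForms hα (c := u) fun J => (u J).2
  -- the form `f(∂u) - d f(u)`, where `∂u` is regarded as the locally constant cochain `c`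
  refine ⟨⟨_, sub_mem hf hd⟩, fun i₀ x hx => ?_, ?_⟩
  · rw [← CechDeRham.cochainForm_cobd_sub_extD hα hu hc hx, ← CechDeRham.cechForm_mapCochain hc]
    rfl
  · rw [hδc]
    refine hΦc.trans ((Submodule.Quotient.eq _).2 ?_)
    exact ⟨CechDeRham.cochainForm U α u, CechDeRham.isSmoothForm_cochainForm hα fun J => (u J).2,
      (sub_sub_cancel _ _).symm⟩
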